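/- All alphabets are finite and non-empty. Let $p_S$ be a distribution on $\mathcal S$, let $\{S(t)\}_{t\ge 1}$ be i.i.d. with law $p_S$, let $p_{Y_1,Y_2|X}$ be a discrete memoryless broadcast channel with input alphabet $\mathcal X$ and output alphabets $\mathcal Y_1,\mathcal Y_2$, and let $w_i:\mathcal S\times\hat{\mathcal S}_i\to[0,\infty)$, $i=1,2$, be distortion measures. For $\kappa\in\mathbb R$, a pair $(d_1,d_2)\in\mathbb R^2$ is *achievable subject to bandwidth expansion constraint $\kappa$* if for every $\epsilon>0$ there are integers $m\ge 1$, $n\ge 0$ with $n/m\le\kappa+\epsilon$, an encoder $f:\mathcal S^m\to\mathcal X^{n}$ and decoders $g_i:\mathcal Y_i^{n}\to\hat{\mathcal S}_i^m$, $i=1,2$, such that, when $X^n=f(S^m)$ is sent over $n$ uses of the channel and $\hat S_i^m=g_i(Y_i^n)$, one has $\frac1m\sum_{t=1}^m\mathbb E[w_i(S(t),\hat S_i(t))]\le d_i+\epsilon$ for $i=1,2$. Suppose $(d_1,d_2)$ is achievable subject to bandwidth expansion constraint $\kappa$. Then there exist a conditional distribution (virtual broadcast channel) $p_{\hat S_1,\hat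 S_2|S}$ with $\mathbb E[w_i(S,\hat S_i)]\le d_i$, $i=1,2$ (expectation under $p_Sp_{\hat S_1,\hat S_2|S}$), and a distribution $p_X$ on $\mathcal X$ such that the following condition holds. $(\ast)$ For every $p_{U_0,U_1,U_2|S}$ with finite alphabets $\mathcal U_0,\mathcal U_1,\mathcal U_2$ there exists $p_{V_0,V_1,V_2|X}$ with finite alphabets $\mathcal V_0,\mathcal V_1,\mathcal V_2$ such that, under $p_{U_0,U_1,U_2|S}\,p_S\,p_{\hat S_1,\hat S_2|S}$ and $p_{V_0,V_1,V_2|X}\,p_X\,p_{Y_1,Y_2|X}$, \begin{align*} &I(U_0;\hat S_i)\le\kappa I(V_0;Y_i),\quad i=1,2,\\ &I(U_0,U_i;\hat S_i)\le\kappa I(V_0,V_i;Y_i),\quad i=1,2,\\ &I(U_0;\hat S_1)+I(U_2;\hat S_2|U_0)\le\kappa[I(V_0;Y_1)+I(V_2;Y_2|V_0)],\\ &I(U_0;\hat S_2)+I(U_1;\hat S_1|U_0)\le\kappa[I(V_0;Y_2)+I(V_1;Y_1|V_0)],\\ &I(U_0,U_1;\hat S_1)+I(S;\hat S_2|U_0,U_1)\le\kappa[I(V_0,V_1;Y_1)+I(X;Y_2|V_0,V_1)],\\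 &I(U_0,U_2;\hat S_2)+I(S;\hat S_1|U_0,U_2)\le\kappa[I(V_0,V_2;Y_2)+I(X;Y_1|V_0,V_2)],\\ &I(U_0;\hat S_1)+I(U_2;\hat S_2|U_0)+I(S;\hat S_1|U_0,U_2)\le\kappa[I(V_0;Y_1)+I(V_2;Y_2|V_0)+I(X;Y_1|V_0,V_2)],\\ &I(U_0;\hat S_2)+I(U_1;\hat S_1|U_0)+I(S;\hat S_2|U_0,U_1)\le\kappa[I(V_0;Y_2)+I(V_1;Y_1|V_0)+I(X;Y_2|V_0,V_1)]. \end{align*} Moreover, for the above pair $p_{\hat S_1,\hat S_2|S}$, $p_X$ the alphabets in $(\ast)$ can, for every $p_{U_0,U_1,U_2|S}$, be taken with $|\mathcal V_0|\le|\mathcal X|+5$ and $|\mathcal V_i|\le|\mathcal X|$, $i=1,2$. Furthermore, it suffices to consider bounded alphabets: for every $p_{\hat S_1,\hat S_2|S}$ and every $p_X$, condition $(\ast)$ is equivalent to the condition obtained from it by restricting to $|\mathcal U_i|\le|\mathcal S|$, $i=0,1,2$, and requiring $|\mathcal V_0|\le|\mathcal X|+5$ and $|\mathcal V_i|\le|\mathcal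 X|$, $i=1,2$. -/

import Mathlib

open scoped NNReal

namespace SourceBroadcast

noncomputable section

/-- Probability mass functions on the finite alphabet `A`. -/
abbrev Distr (A : Type*) [Fintype A] : Type _ := stdSimplex ℝ A

/-- Conditional distributions `p_{B|A}`: a mass function on `B` for every `a : A`. -/
abbrev Channel (A B : Type*) [Fintype B] : Type _ := A → Distr B

section Information

variable {Ω A B C : Type*} [Fintype Ω] [Fintype A] [Fintype B] [Fintype C]

/-- The Shannon entropy `H(X)` (in nats) of the random variable `X` on the finite probability
space `(Ω, p)`; `stdSimplex.map X p` is the distribution of `X`. -/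
def entropy (p : Distr Ω) (X : Ω → A) : ℝ :=
  ∑ a, Real.negMulLog (stdSimplex.map X p a)

/-- The mutual information `I(X;Y) = H(X) + H(Y) - H(X,Y)`. -/
def mutualInfo (p : Distr Ω) (X : Ω → A) (Y : Ω → B) : ℝ :=
  entropy p X + entropy p Y - entropy p (fun ω => (X ω, Y ω))

/-- The conditional mutual information
`I(X;Y|Z) = H(X,Z) + H(Y,Z) - H(X,Y,Z) - H(Z)`. -/
def condMutualInfo (p : Distr Ω) (X : Ω → A) (Y : Ω → B) (Z : Ω → C) : ℝ :=
  entropy p (fun ω => (X ω, Z ω)) + entropy p (fun ω => (Y ω, Z ω))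
    - entropy p (fun ω => (X ω, Y ω, Z ω)) - entropy p Z

end Information

section Coding

variable {S T₁ T₂ X Y₁ Y₂ : Type*}
  [Fintype S] [Fintype T₁] [Fintype T₂] [Fintype X] [Fintype Y₁] [Fintype Y₂]

/-- The probability that the i.i.d. source emits the block `s` and that the memoryless broadcast
channel `W`, fed with the codeword `f s`, then outputs the block `y` of output pairs. -/
def blockProb (pS : Distr S) (W : Channel X (Y₁ × Y₂)) {m n : ℕ}
    (f : (Fin m → S) → (Fin n → X)) (s : Fin m → S) (y : Fin n → Y₁ × Y₂) : ℝ :=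
  (∏ t, pS (s t)) * ∏ q, W (f s q) (y q)

/-- The average expected distortion `(1/m) ∑ₜ E[w(S(t), Ŝ(t))]`, where the block of
reconstructions `Ŝ` is the function `g` of the block of output pairs. -/
def blockDistortion {T : Type*} (pS : Distr S) (W : Channel X (Y₁ × Y₂)) {m n : ℕ}
    (f : (Fin m → S) → (Fin n → X)) (g : (Fin n → Y₁ × Y₂) → (Fin m → T))
    (w : S → T → ℝ≥0) : ℝ :=
  (1 / (m : ℝ)) * ∑ t : Fin m,
    ∑ s : Fin m → S, ∑ y : Fin n → Y₁ × Y₂, blockProb pS W f s y * (w (s t) (g y t) : ℝ)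

/-- The distortion pair `(d₁, d₂)` is achievable under the distortion measures `w₁`, `w₂` subject
to the bandwidth expansion constraint `κ`: for every `ε > 0` there are a source block length
`m ≥ 1`, a channel block length `n` with `n / m ≤ κ + ε`, an encoder `f` and decoders `g₁`, `g₂`
(decoder `i` sees only the `i`-th components of the outputs) with distortions at most
`dᵢ + ε`. -/
def Achievable (pS : Distr S) (W : Channel X (Y₁ × Y₂)) (w₁ : S → T₁ → ℝ≥0) (w₂ : S → T₂ → ℝ≥0)
    (κ d₁ d₂ : ℝ) : Prop :=
  ∀ ε : ℝ, 0 < ε → ∃ (m n : ℕ) (f : (Fin m → S) → (Fin n → X))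
    (g₁ : (Fin n → Y₁) → (Fin m → T₁)) (g₂ : (Fin n → Y₂) → (Fin m → T₂)),
    0 < m ∧ (n : ℝ) / (m : ℝ) ≤ κ + ε ∧
    blockDistortion pS W f (fun y => g₁ (fun q => (y q).1)) w₁ ≤ d₁ + ε ∧
    blockDistortion pS W f (fun y => g₂ (fun q => (y q).2)) w₂ ≤ d₂ + ε

/-- `E[w₁(S, Ŝ₁)]` under `p_S p_{Ŝ₁,Ŝ₂|S}`. -/
def distortion₁ (pS : Distr S) (Q : Channel S (T₁ × T₂)) (w₁ : S → T₁ → ℝ≥0) : ℝ :=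
  ∑ s, ∑ r : T₁ × T₂, pS s * Q s r * (w₁ s r.1 : ℝ)

/-- `E[w₂(S, Ŝ₂)]` under `p_S p_{Ŝ₁,Ŝ₂|S}`. -/
def distortion₂ (pS : Distr S) (Q : Channel S (T₁ × T₂)) (w₂ : S → T₂ → ℝ≥0) : ℝ :=
  ∑ s, ∑ r : T₁ × T₂, pS s * Q s r * (w₂ s r.2 : ℝ)

end Coding

section Test

variable {A B₁ B₂ C₀ C₁ C₂ : Type*}
  [Fintype A] [Fintype B₁] [Fintype B₂] [Fintype C₀] [Fintype C₁] [Fintype C₂]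

/-- The joint distribution `p_{C₀,C₁,C₂|A} p_A p_{B₁,B₂|A}` of `((C₀, C₁, C₂), A, (B₁, B₂))`. -/
def joint (θ : Channel A (C₀ × C₁ × C₂)) (p : Distr A) (K : Channel A (B₁ × B₂)) :
    Distr ((C₀ × C₁ × C₂) × A × (B₁ × B₂)) :=
  ⟨fun ω => θ ω.2.1 ω.1 * p ω.2.1 * K ω.2.1 ω.2.2, by
    refine ⟨fun ω => mul_nonneg (mul_nonneg ((θ ω.2.1).2.1 _) (p.2.1 _)) ((K ω.2.1).2.1 _), ?_⟩
    have hθ : ∀ a, ∑ c, θ a c = 1 := fun a => (θ a).2.2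
    have hK : ∀ a, ∑ b, K a b = 1 := fun a => (K a).2.2
    have hp : ∑ a, p a = 1 := p.2.2
    rw [Fintype.sum_prod_type_right, Fintype.sum_prod_type]
    simp only [← Finset.sum_mul, hθ, one_mul, ← Finset.mul_sum, hK, mul_one, hp]⟩

/-- The ten information quantities that the test distribution `θ = p_{C₀,C₁,C₂|A}` induces on the
broadcast channel `K = p_{B₁,B₂|A}` with input distribution `p = p_A`. On the source side
`(A, B₁, B₂, C₀, C₁, C₂)` is `(S, Ŝ₁, Ŝ₂, U₀, U₁, U₂)`, on the channel side it is
`(X, Y₁, Y₂, V₀, V₁, V₂)`. -/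
def measurements (θ : Channel A (C₀ × C₁ × C₂)) (p : Distr A) (K : Channel A (B₁ × B₂)) :
    Fin 10 → ℝ :=
  let μ := joint θ p K
  let c₀ : (C₀ × C₁ × C₂) × A × (B₁ × B₂) → C₀ := fun ω => ω.1.1
  let c₁ : (C₀ × C₁ × C₂) × A × (B₁ × B₂) → C₁ := fun ω => ω.1.2.1
  let c₂ : (C₀ × C₁ × C₂) × A × (B₁ × B₂) → C₂ := fun ω => ω.1.2.2
  let c₀₁ : (C₀ × C₁ × C₂) × A × (B₁ × B₂) → C₀ × C₁ := fun ω => (ω.1.1, ω.1.2.1)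
  let c₀₂ : (C₀ × C₁ × C₂) × A × (B₁ × B₂) → C₀ × C₂ := fun ω => (ω.1.1, ω.1.2.2)
  let a : (C₀ × C₁ × C₂) × A × (B₁ × B₂) → A := fun ω => ω.2.1
  let b₁ : (C₀ × C₁ × C₂) × A × (B₁ × B₂) → B₁ := fun ω => ω.2.2.1
  let b₂ : (C₀ × C₁ × C₂) × A × (B₁ × B₂) → B₂ := fun ω => ω.2.2.2
  ![mutualInfo μ c₀ b₁,
    mutualInfo μ c₀ b₂,
    mutualInfo μ c₀₁ b₁,
    mutualInfo μ c₀₂ b₂,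
    mutualInfo μ c₀ b₁ + condMutualInfo μ c₂ b₂ c₀,
    mutualInfo μ c₀ b₂ + condMutualInfo μ c₁ b₁ c₀,
    mutualInfo μ c₀₁ b₁ + condMutualInfo μ a b₂ c₀₁,
    mutualInfo μ c₀₂ b₂ + condMutualInfo μ a b₁ c₀₂,
    mutualInfo μ c₀ b₁ + condMutualInfo μ c₂ b₂ c₀ + condMutualInfo μ a b₁ c₀₂,
    mutualInfo μ c₀ b₂ + condMutualInfo μ c₁ b₁ c₀ + condMutualInfo μ a b₂ c₀₁]

end Test

end

end SourceBroadcast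

open SourceBroadcast

namespace SourceBroadcast

noncomputable section

open Real (negMulLog log negMulLog_mul concaveOn_negMulLog log_inv continuous_negMulLog)

/-! ### The entropy functional of an unnormalised mass function -/

section EntropyFunctional

variable {B ι : Type*} [Fintype B]

/-! If conditional laws are left unnormalised and entropy is made homogeneous of degree one, H(Y|V)
is a plain sum over the values of V. Hence the input law of a test channel and the six entropies
H(Y₁|V₀), H(Y₂|V₀), H(Y₁|V₀V₁), H(Y₂|V₀V₂), H(Y₁|V₀V₂), H(Y₂|V₀V₁) form a vector of a convex cone,
`entropyCone`. The ten information quantities are functions `infoBounds` of this vector,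
homogeneous, and affine as long as the law is fixed. All inequalities rest on the superadditivity
`homEntropy_add_le`.

Converse. For a given code, let the test variables be generated letter by letter from the source,
and let `Q` be the law of the reconstructions given the source letter at a uniformly random time.
The pairs (test variable, source letter) are i.i.d. and conditional entropy is concave, so m times
each single-letter quantity is at most its block analogue (`IsVirtualChannel.measurements_le`). The
block quantity is at most `infoBounds` of a sum over time of cone vectors, the common auxiliary
variable at time q being U₀ᵐ with the past of Y₁ and the future of Y₂; the Csiszár sum identity
makes the mixed differences match exactly (`IsMemoryless.infoVector_le`). Division by n gives a cone
vector whose law `pX` is the time average of the input laws. Neither `Q` nor `pX` depends on the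
test. As the alphabets of V are bounded, compactness allows ε → 0.

Cardinalities. The tool is a conic Carathéodory theorem, `sum_mem_convexHull_small`. V₁ and V₂ occur
only with V₀, never together, so for each value of V₀ they are reduced separately while keeping just
the sub-law of the input: |X| letters, the mixing being absorbed into V₀. For V₀ one keeps the law
and five entropies, |X| + 5 in all; the sixth enters only with a plus sign, so some member of the
mixture does at least as well. On the source side one keeps the law only: an arbitrary test is a
mixture of tests with |S| letters, and the matching physical vectors are mixed with the same
weights. -/

/-- For `v = c • p` with `p` a mass function, this is `c` times the entropy of `p`. -/
def homEntropy (v : B → ℝ) : ℝ := ∑ b, negMulLog (v b) - negMulLog (∑ b, v b)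

@[simp] lemma homEntropy_zero : homEntropy (0 : B → ℝ) = 0 := by simp [homEntropy]

lemma homEntropy_smul (c : ℝ) (v : B → ℝ) : homEntropy (c • v) = c * homEntropy v := by
  simp only [homEntropy, Pi.smul_apply, smul_eq_mul, ← Finset.mul_sum, negMulLog_mul,
    Finset.sum_add_distrib, ← Finset.sum_mul]
  ring

lemma homEntropy_eq_of_sum_eq_one {v : B → ℝ} (hv : ∑ b, v b = 1) :
    homEntropy v = ∑ b, negMulLog (v b) := by simp [homEntropy, hv]

/-- Concavity of `negMulLog` at x/X and y/Y with weights X/(X+Y) and Y/(X+Y), multiplied by X+Y. The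
bounds x ≤ X and y ≤ Y settle the degenerate cases X = 0 and Y = 0. -/
lemma log_sum_two {x y X Y : ℝ} (hx : 0 ≤ x) (hy : 0 ≤ y) (hxX : x ≤ X) (hyY : y ≤ Y) :
    (negMulLog x + x * log X) + (negMulLog y + y * log Y) ≤
      negMulLog (x + y) + (x + y) * log (X + Y) := by
  rcases (hx.trans hxX).eq_or_lt with hX | hX
  · obtain rfl : x = 0 := le_antisymm (hX ▸ hxX) hx
    simp [← hX]
  rcases (hy.trans hyY).eq_or_lt with hY | hY
  · obtain rfl : y = 0 := le_antisymm (hY ▸ hyY) hy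
    simp [← hY]
  have key : ∀ {a b : ℝ}, 0 < b → b * negMulLog (a / b) = negMulLog a + a * log b := by
    intro a b hb
    rw [div_eq_mul_inv, negMulLog_mul, negMulLog, negMulLog, log_inv]
    field_simp
  have hXY : 0 < X + Y := by positivity
  have h := concaveOn_negMulLog.2 (show x / X ∈ Set.Ici 0 from div_nonneg hx hX.le)
    (show y / Y ∈ Set.Ici 0 from div_nonneg hy hY.le) (show 0 ≤ X / (X + Y) by positivity)
    (show 0 ≤ Y / (X + Y) by positivity) (by field_simp)
  have e : (X / (X + Y)) • (x / X) + (Y / (X + Y)) • (y / Y) = (x + y) / (X + Y) := by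
    simp only [smul_eq_mul]; field_simp
  rw [e] at h
  have h2 := mul_le_mul_of_nonneg_left h hXY.le
  rw [key hXY] at h2
  rw [← key hX, ← key hY]
  refine le_trans (le_of_eq ?_) h2
  simp only [smul_eq_mul]; field_simp

lemma homEntropy_eq_sum (v : B → ℝ) :
    homEntropy v = ∑ b, (negMulLog (v b) + v b * log (∑ b, v b)) := by
  rw [Finset.sum_add_distrib, ← Finset.sum_mul, homEntropy, negMulLog.eq_1 (∑ b, v b)]
  ring

/-- Together with homogeneity this is the concavity of entropy; "conditioning reduces entropy"
follows by merging the values of the condition. -/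
lemma homEntropy_add_le {v w : B → ℝ} (hv : 0 ≤ v) (hw : 0 ≤ w) :
    homEntropy v + homEntropy w ≤ homEntropy (v + w) := by
  simp only [homEntropy_eq_sum, ← Finset.sum_add_distrib, Pi.add_apply]
  refine Finset.sum_le_sum fun b _ => ?_
  rw [Finset.sum_add_distrib]
  exact log_sum_two (hv b) (hw b) (Finset.single_le_sum (fun i _ => hv i) (Finset.mem_univ b))
    (Finset.single_le_sum (fun i _ => hw i) (Finset.mem_univ b))

lemma sum_homEntropy_le (s : Finset ι) {v : ι → B → ℝ} (hv : ∀ i, 0 ≤ v i) :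
    ∑ i ∈ s, homEntropy (v i) ≤ homEntropy (∑ i ∈ s, v i) := by
  classical
  induction s using Finset.induction_on with
  | empty => simp
  | insert a s ha ih =>
    rw [Finset.sum_insert ha, Finset.sum_insert ha]
    exact (add_le_add_right ih _).trans
      (homEntropy_add_le (hv a) (Finset.sum_nonneg fun i _ => hv i))

end EntropyFunctional

/-! ### Distributions and entropies of random variables on a finite probability space -/

section Variables

variable {Ω A B C D : Type*} [Fintype Ω] [Fintype A] [Fintype B] [Fintype C] [Fintype D]

/-- `P(X = a)`. -/
def prob (p : Distr Ω) (X : Ω → A) (a : A) : ℝ := stdSimplex.map X p a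

open Classical in
lemma prob_eq (p : Distr Ω) (X : Ω → A) (a : A) :
    prob p X a = ∑ ω, if X ω = a then p ω else 0 := by
  rw [prob, stdSimplex.map_coe, FunOnFinite.linearMap_apply_apply, Finset.sum_filter]

lemma prob_nonneg (p : Distr Ω) (X : Ω → A) (a : A) : 0 ≤ prob p X a := (stdSimplex.map X p).2.1 a

lemma prob_nonneg' (p : Distr Ω) (X : Ω → A) : 0 ≤ prob p X := fun a => prob_nonneg p X a

lemma sum_prob (p : Distr Ω) (X : Ω → A) : ∑ a, prob p X a = 1 := (stdSimplex.map X p).2.2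

/-- The law of a function of a random variable. -/
lemma sum_prob_mul (p : Distr Ω) (X : Ω → A) (g : A → ℝ) :
    ∑ a, prob p X a * g a = ∑ ω, p ω * g (X ω) := by
  classical
  simp only [prob_eq, Finset.sum_mul, ite_mul, zero_mul]
  rw [Finset.sum_comm]
  simp

open Classical in
lemma prob_comp (p : Distr Ω) (X : Ω → A) (g : A → B) (b : B) :
    prob p (fun ω => g (X ω)) b = ∑ a, if g a = b then prob p X a else 0 := by
  have := sum_prob_mul p X (fun a => if g a = b then 1 else 0)
  simp only [mul_ite, mul_one, mul_zero] at this
  rw [this, prob_eq]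

lemma sum_prob_left (p : Distr Ω) (X : Ω → A) (Y : Ω → B) (b : B) :
    ∑ a, prob p (fun ω => (X ω, Y ω)) (a, b) = prob p Y b := by
  classical
  rw [show Y = fun ω => ((X ω, Y ω) : A × B).2 from rfl,
    prob_comp p (fun ω => (X ω, Y ω)) Prod.snd, Fintype.sum_prod_type]
  simp

lemma sum_prob_right (p : Distr Ω) (X : Ω → A) (Y : Ω → B) (a : A) :
    ∑ b, prob p (fun ω => (X ω, Y ω)) (a, b) = prob p X a := by
  classical
  rw [show X = fun ω => ((X ω, Y ω) : A × B).1 from rfl,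
    prob_comp p (fun ω => (X ω, Y ω)) Prod.fst, Fintype.sum_prod_type_right]
  simp

lemma entropy_eq (p : Distr Ω) (X : Ω → A) : entropy p X = ∑ a, negMulLog (prob p X a) := rfl

lemma entropy_eq_homEntropy (p : Distr Ω) (X : Ω → A) : entropy p X = homEntropy (prob p X) :=
  (homEntropy_eq_of_sum_eq_one (sum_prob p X)).symm

open Classical in
-- In this form the values of `X` enter only through the relation `X ω' = X ω`, so differently typed
-- variables with the same partition can be exchanged.
lemma entropy_eq_sum_kernel (p : Distr Ω) (X : Ω → A) :
    entropy p X = ∑ ω, p ω * -log (∑ ω', if X ω' = X ω then p ω' else 0) := by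
  simp only [← prob_eq]
  rw [← sum_prob_mul p X (fun a => -log (prob p X a)), entropy_eq]
  simp [negMulLog]

/-- Entropy only depends on the partition that a random variable generates. -/
lemma entropy_congr (p : Distr Ω) {X : Ω → A} {Y : Ω → B}
    (h : ∀ ω ω', X ω = X ω' ↔ Y ω = Y ω') : entropy p X = entropy p Y := by
  classical
  simp only [entropy_eq_sum_kernel, h]

/-- The conditional entropy `H(X|Z)`. -/
def condEntropy (p : Distr Ω) (X : Ω → A) (Z : Ω → C) : ℝ :=
  entropy p (fun ω => (X ω, Z ω)) - entropy p Z

/-- Unnormalised conditional laws need no division, hence no separate treatment of null events. -/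
lemma condEntropy_eq_sum (p : Distr Ω) (X : Ω → A) (Z : Ω → C) :
    condEntropy p X Z = ∑ z, homEntropy (fun x => prob p (fun ω => (X ω, Z ω)) (x, z)) := by
  simp only [condEntropy, homEntropy, entropy_eq, Finset.sum_sub_distrib, sum_prob_left]
  rw [Fintype.sum_prod_type_right]

lemma condEntropy_congr (p : Distr Ω) {X : Ω → A} {Z : Ω → C} {X' : Ω → B} {Z' : Ω → D}
    (h : ∀ ω ω', (X ω = X ω' ∧ Z ω = Z ω') ↔ (X' ω = X' ω' ∧ Z' ω = Z' ω'))
    (hZ : ∀ ω ω', Z ω = Z ω' ↔ Z' ω = Z' ω') : condEntropy p X Z = condEntropy p X' Z' := by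
  unfold condEntropy
  rw [entropy_congr p hZ]
  congr 1
  exact entropy_congr p (by simpa [Prod.ext_iff] using h)

lemma condEntropy_comp_le (p : Distr Ω) (X : Ω → A) (Z : Ω → C) (g : C → D) :
    condEntropy p X Z ≤ condEntropy p X (fun ω => g (Z ω)) := by
  classical
  simp only [condEntropy_eq_sum]
  have e : ∀ d, (fun x => prob p (fun ω => (X ω, g (Z ω))) (x, d)) =
      ∑ z ∈ Finset.univ.filter (fun z => g z = d),
        (fun x => prob p (fun ω => (X ω, Z ω)) (x, z)) := by
    intro d
    ext x
    rw [Finset.sum_apply, Finset.sum_filter,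
      prob_comp p (fun ω => (X ω, Z ω)) (fun t => (t.1, g t.2)), Fintype.sum_prod_type,
      Finset.sum_eq_single x]
    · simp
    · intro y _ hy; simp [hy]
    · simp
  calc _ = ∑ d, ∑ z ∈ Finset.univ.filter (fun z => g z = d),
        homEntropy (fun x => prob p (fun ω => (X ω, Z ω)) (x, z)) :=
        (Finset.sum_fiberwise _ _ _).symm
    _ ≤ _ := Finset.sum_le_sum fun d _ => by
        rw [e d]
        exact sum_homEntropy_le _ fun z x => prob_nonneg _ _ _

/-- Conditioning on more reduces entropy. -/
lemma condEntropy_anti (p : Distr Ω) (X : Ω → A) {Z : Ω → C} {Z' : Ω → D}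
    (h : ∀ ω ω', Z' ω = Z' ω' → Z ω = Z ω') : condEntropy p X Z' ≤ condEntropy p X Z := by
  calc condEntropy p X Z' = condEntropy p X (fun ω => (Z ω, Z' ω)) :=
        condEntropy_congr p (fun ω ω' => by simp only [Prod.mk.injEq]; have := h ω ω'; tauto)
          (fun ω ω' => by simp only [Prod.mk.injEq]; have := h ω ω'; tauto)
    _ ≤ condEntropy p X Z := condEntropy_comp_le p X (fun ω => (Z ω, Z' ω)) Prod.fst

lemma entropy_unit (p : Distr Ω) : entropy p (fun _ => ()) = 0 := by
  have := sum_prob p (fun _ : Ω => ())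
  simp only [Finset.univ_unique, Finset.sum_singleton] at this
  simp [entropy_eq, this]

lemma condEntropy_unit (p : Distr Ω) (X : Ω → A) : condEntropy p X (fun _ => ()) = entropy p X := by
  rw [condEntropy, entropy_unit, sub_zero]
  exact entropy_congr p (by simp)

lemma condEntropy_le_entropy (p : Distr Ω) (X : Ω → A) (Z : Ω → C) :
    condEntropy p X Z ≤ entropy p X := by
  have h := condEntropy_anti p X (Z := fun _ => ()) (Z' := Z) (by simp)
  exact h.trans_eq (condEntropy_unit p X)

lemma mutualInfo_eq (p : Distr Ω) (X : Ω → A) (Y : Ω → B) :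
    mutualInfo p X Y = entropy p Y - condEntropy p Y X := by
  rw [mutualInfo, condEntropy, entropy_congr p (X := fun ω => (Y ω, X ω))
    (Y := fun ω => (X ω, Y ω)) (by simp [and_comm])]
  ring

lemma condMutualInfo_eq (p : Distr Ω) (X : Ω → A) (Y : Ω → B) (Z : Ω → C) :
    condMutualInfo p X Y Z = condEntropy p Y Z - condEntropy p Y (fun ω => (X ω, Z ω)) := by
  rw [condMutualInfo, condEntropy, condEntropy, entropy_congr p (X := fun ω => (X ω, Y ω, Z ω))
    (Y := fun ω => (Y ω, X ω, Z ω)) (by simp only [Prod.mk.injEq]; tauto)]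
  ring

/-- This expansion serves the source side, where the entropy of the test variables is additive; the
channel side uses `condMutualInfo_eq`. -/
lemma condMutualInfo_eq' (p : Distr Ω) (X : Ω → A) (Y : Ω → B) (Z : Ω → C) :
    condMutualInfo p X Y Z = condEntropy p X Z - condEntropy p X (fun ω => (Y ω, Z ω)) := by
  rw [condMutualInfo, condEntropy, condEntropy]
  ring

lemma mutualInfo_eq_condMutualInfo (p : Distr Ω) (X : Ω → A) (Y : Ω → B) :
    mutualInfo p X Y = condMutualInfo p X Y (fun _ => ()) := by
  rw [mutualInfo, condMutualInfo, entropy_unit, sub_zero,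
    entropy_congr p (X := fun ω => (X ω, ())) (Y := X) (by simp),
    entropy_congr p (X := fun ω => (Y ω, ())) (Y := Y) (by simp),
    entropy_congr p (X := fun ω => (X ω, Y ω, ())) (Y := fun ω => (X ω, Y ω)) (by simp)]

lemma continuous_entropy (X : Ω → A) : Continuous fun p : Distr Ω => entropy p X := by
  unfold entropy
  refine continuous_finsetSum _ fun a _ => continuous_negMulLog.comp ?_
  exact (continuous_apply a).comp (continuous_subtype_val.comp (stdSimplex.continuous_map X))

end Variables

/-! ### Conic combinations with small support -/

section SmallSupport

variable {ι E : Type*} [Fintype ι] [AddCommGroup E] [Module ℝ E]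

open Classical in
/-- The support of a weight function. -/
def weightSupport (q : ι → ℝ) : Finset ι := Finset.univ.filter fun i => q i ≠ 0

lemma mem_weightSupport {q : ι → ℝ} {i : ι} : i ∈ weightSupport q ↔ q i ≠ 0 := by
  simp [weightSupport]

/-- Moving from `q ≥ 0` in a direction `d` with a negative entry, one reaches the boundary. -/
lemma exists_shrink_support {q d : ι → ℝ} (hq : 0 ≤ q) (hd : ∀ i, q i = 0 → d i = 0)
    (hneg : ∃ i, d i < 0) :
    ∃ t : ℝ, 0 < t ∧ 0 ≤ q + t • d ∧ (weightSupport (q + t • d)).card < (weightSupport q).card := by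
  classical
  obtain ⟨i₀, hi₀⟩ := hneg
  obtain ⟨i, hi, hmin⟩ := Finset.exists_min_image (Finset.univ.filter fun i => d i < 0)
    (fun i => q i / -d i) ⟨i₀, by simpa using hi₀⟩
  simp only [Finset.mem_filter, Finset.mem_univ, true_and] at hi hmin
  have hqi : 0 < q i := lt_of_le_of_ne (hq i) fun h => hi.ne (hd i h.symm)
  refine ⟨q i / -d i, div_pos hqi (neg_pos.2 hi), fun j => ?_, Finset.card_lt_card ?_⟩
  · simp only [Pi.zero_apply, Pi.add_apply, Pi.smul_apply, smul_eq_mul]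
    rcases lt_or_ge (d j) 0 with hj | hj
    · have := hmin j hj
      rw [le_div_iff₀ (neg_pos.2 hj)] at this
      linarith
    · exact add_nonneg (hq j) (mul_nonneg (div_nonneg hqi.le (neg_pos.2 hi).le) hj)
  · refine Finset.ssubset_iff_subset_ne.2 ⟨fun j hj => ?_, fun h => ?_⟩
    · rw [mem_weightSupport] at hj ⊢
      intro h0
      simp [h0, hd j h0] at hj
    · have : i ∈ weightSupport (q + (q i / -d i) • d) := h ▸ mem_weightSupport.2 hqi.ne'
      rw [mem_weightSupport] at this
      refine this ?_
      simp only [Pi.add_apply, Pi.smul_apply, smul_eq_mul]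
      field_simp [hi.ne]
      ring

/-- A conic combination of vectors of positive mass is a mixture of conic combinations with the
same value, each of which uses at most as many vectors as the dimension. -/
theorem mem_convexHull_small_support [FiniteDimensional ℝ E] (v : ι → E) (l : E →ₗ[ℝ] ℝ)
    (hl : ∀ i, 0 < l (v i)) (q : ι → ℝ) (hq : 0 ≤ q) :
    q ∈ convexHull ℝ {q' : ι → ℝ | 0 ≤ q' ∧ ∑ i, q' i • v i = ∑ i, q i • v i ∧
      (weightSupport q').card ≤ Module.finrank ℝ E} := by
  classical
  induction hn : (weightSupport q).card using Nat.strong_induction_on generalizing q with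
  | _ n ih =>
  by_cases hc : (weightSupport q).card ≤ Module.finrank ℝ E
  · exact subset_convexHull _ _ ⟨hq, rfl, hc⟩
  have hdep : ¬ LinearIndependent ℝ (fun i : weightSupport q => v i) := fun h =>
    hc (by simpa using h.fintype_card_le_finrank)
  obtain ⟨g, hg, i₀, hi₀⟩ := Fintype.not_linearIndependent_iff.1 hdep
  set d : ι → ℝ := fun i => if h : i ∈ weightSupport q then g ⟨i, h⟩ else 0 with hd
  have hdq : ∀ i, q i = 0 → d i = 0 := fun i hi => by simp [hd, mem_weightSupport, hi]
  have hdsum : ∑ i, d i • v i = 0 := by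
    rw [← hg, ← Finset.sum_subset (Finset.subset_univ (weightSupport q))
      (fun i _ hi => by simp [hd, hi]), ← Finset.sum_coe_sort]
    exact Finset.sum_congr rfl fun i _ => by simp [hd]
  -- Since `l` is positive on all the vectors, a nonzero relation has coefficients of both signs.
  -- One can therefore reach the boundary in both directions `d` and `-d`, and `q` lies between the
  -- two end points.
  have hdl : ∑ i, d i * l (v i) = 0 := by simpa using congrArg l hdsum
  have hd0 : d i₀ ≠ 0 := by simpa [hd] using hi₀
  have hneg : ∃ i, d i < 0 := by
    by_contra! h
    have := (Finset.sum_eq_zero_iff_of_nonneg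
      (fun i _ => mul_nonneg (h i) (hl i).le)).1 hdl i₀ (Finset.mem_univ _)
    exact hd0 ((mul_eq_zero.1 this).resolve_right (hl _).ne')
  have hpos : ∃ i, (-d) i < 0 := by
    by_contra! h
    have := (Finset.sum_eq_zero_iff_of_nonpos
      (fun i _ => mul_nonpos_of_nonpos_of_nonneg (by simpa using h i) (hl i).le)).1 hdl i₀
      (Finset.mem_univ _)
    exact hd0 ((mul_eq_zero.1 this).resolve_right (hl _).ne')
  obtain ⟨t, ht, htq, htc⟩ := exists_shrink_support hq hdq hneg
  obtain ⟨s, hs, hsq, hsc⟩ := exists_shrink_support (d := -d) hq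
    (fun i hi => by simp [hdq i hi]) hpos
  have e₁ : ∑ i, (q + t • d) i • v i = ∑ i, q i • v i := by
    simp [add_smul, Finset.sum_add_distrib, mul_smul, ← Finset.smul_sum, hdsum]
  have e₂ : ∑ i, (q + s • -d) i • v i = ∑ i, q i • v i := by
    simp [add_smul, Finset.sum_add_distrib, mul_smul, ← Finset.smul_sum, hdsum]
  have h₁ := ih _ (hn ▸ htc) _ htq rfl
  have h₂ := ih _ (hn ▸ hsc) _ hsq rfl
  rw [e₁] at h₁
  rw [e₂] at h₂
  have := convex_convexHull ℝ _ h₁ h₂ (a := s / (s + t)) (b := t / (s + t)) (by positivity)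
    (by positivity) (by field_simp)
  convert this using 1
  ext i
  simp only [Pi.add_apply, Pi.smul_apply, Pi.neg_apply, smul_eq_mul]
  field_simp
  ring

/-- A point of a convex hull does not exceed all the generating points under a linear functional. -/
lemma exists_le_of_mem_convexHull {F : Type*} [AddCommGroup F] [Module ℝ F] {s : Set F} {x : F}
    (hx : x ∈ convexHull ℝ s) (c : F →ₗ[ℝ] ℝ) : ∃ y ∈ s, c x ≤ c y := by
  by_contra! h
  have := convexHull_min (t := {y | c y < c x}) (fun y hy => h y hy)
    (convex_halfSpace_lt c.isLinear _) hx
  exact lt_irrefl (c x) this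

lemma sum_extend_zero {α κ M N : Type*} [Fintype α] [Fintype κ] [AddCommMonoid N] [Zero M]
    {e : α → κ} (he : Function.Injective e) (w : α → M) (φ : M → N) (hφ : φ 0 = 0) :
    ∑ j, φ (Function.extend e w 0 j) = ∑ i, φ (w i) := by
  classical
  rw [← Finset.sum_subset (Finset.subset_univ (Finset.univ.image e)), Finset.sum_image he.injOn]
  · simp [he.extend_apply]
  · intro j _ hj
    have : ¬ ∃ i, e i = j := by simpa using hj
    rw [Function.extend_apply' _ _ _ this]
    exact hφ

/-- A family that vanishes outside a finite set can be reindexed along an injection of it. -/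
lemma sum_extend_of_support {α κ M N : Type*} [Fintype α] [Fintype κ] [AddCommMonoid N] [Zero M]
    {w : α → M} {s : Finset α} (hw : ∀ i ∉ s, w i = 0) {e : s → κ} (he : Function.Injective e)
    (φ : M → N) (hφ : φ 0 = 0) :
    ∑ j, φ (Function.extend e (fun i => w i) 0 j) = ∑ i, φ (w i) := by
  rw [sum_extend_zero he _ φ hφ, ← Finset.sum_subset (Finset.subset_univ s)
    (fun i _ hi => by rw [hw i hi, hφ])]
  exact Finset.sum_coe_sort s fun i => φ (w i)

lemma exists_injective_fin {α : Type*} (s : Finset α) {N : ℕ} (hs : s.card ≤ N) :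
    ∃ e : s → Fin N, Function.Injective e := by
  obtain ⟨e⟩ : Nonempty (s ↪ Fin N) := Function.Embedding.nonempty_of_card_le (by simpa using hs)
  exact ⟨e, e.injective⟩

lemma extend_mem {α κ M : Type*} [Zero M] (e : α → κ) (w : α → M) {p : M → Prop} (h0 : p 0)
    (hw : ∀ i, p (w i)) (j : κ) : p (Function.extend e w 0 j) := by
  classical
  rw [Function.extend_def]
  split_ifs with h
  exacts [hw _, h0]

end SmallSupport

/-! ### Conic Carathéodory decomposition -/

section Caratheodory

variable {ι E P : Type*} [Fintype ι] [AddCommGroup E] [Module ℝ E] [FiniteDimensional ℝ E]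
  [AddCommGroup P] [Module ℝ P]

/-- Only the image under `π` is preserved by each short sum; whatever `π` forgets is recovered on
average. The decomposition of the weight vector 1 over the vectors `π (d i)` is pushed forward by
the linear map `q ↦ ∑ qᵢ dᵢ`. -/
theorem sum_mem_convexHull_small {D : Set P} (h0 : (0 : P) ∈ D)
    (hD : ∀ c : ℝ, 0 ≤ c → ∀ x ∈ D, c • x ∈ D) (π : P →ₗ[ℝ] E) (l : E →ₗ[ℝ] ℝ)
    (hl : ∀ x ∈ D, 0 ≤ l (π x)) (hl0 : ∀ x ∈ D, l (π x) = 0 → x = 0)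
    (d : ι → P) (hd : ∀ i, d i ∈ D) {N : ℕ} (hN : Module.finrank ℝ E ≤ N) :
    ∑ i, d i ∈ convexHull ℝ {x | π x = π (∑ i, d i) ∧
      ∃ d' : Fin N → P, (∀ j, d' j ∈ D) ∧ x = ∑ j, d' j} := by
  classical
  -- Zero summands are discarded so that `l` is strictly positive on the others.
  let ι' := {i // d i ≠ 0}
  have hsum : ∑ i : ι', d i = ∑ i, d i := by
    exact (Finset.sum_subtype (Finset.univ.filter fun i => d i ≠ 0) (fun i => by simp) d).symm.trans
      (Finset.sum_filter_ne_zero _)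
  have key := mem_convexHull_small_support (fun i : ι' => π (d i)) l
    (fun i => lt_of_le_of_ne (hl _ (hd i)) fun h => i.2 (hl0 _ (hd i) h.symm))
    (fun _ => 1) (fun _ => zero_le_one)
  let T : (ι' → ℝ) →ₗ[ℝ] P := Fintype.linearCombination ℝ (fun i : ι' => d i)
  have hT : ∀ q, T q = ∑ i : ι', q i • d i := fun q => rfl
  have h1 : T (fun _ => 1) = ∑ i, d i := by simp [hT, ← hsum]
  rw [← h1]
  refine convexHull_mono ?_ ((LinearMap.image_convexHull T _) ▸ Set.mem_image_of_mem T key)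
  rintro _ ⟨q, ⟨hq0, hqs, hqc⟩, rfl⟩
  obtain ⟨e, he⟩ := exists_injective_fin (weightSupport q) (hqc.trans hN)
  refine ⟨?_, Function.extend e (fun i => q i • d i) 0, ?_, ?_⟩
  · simpa [hT] using hqs
  · exact extend_mem _ _ h0 fun i => hD _ (hq0 i) _ (hd i)
  · rw [hT]
    exact (sum_extend_of_support (w := fun i => q i • d i) (s := weightSupport q)
      (fun i hi => by simp [not_not.1 (mt mem_weightSupport.2 hi)]) he id rfl).symm

/-- The nonnegative linear combinations of a set. -/
abbrev coneSpan (D : Set P) : Submodule ℝ≥0 P := Submodule.span ℝ≥0 D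

lemma smul_mem_coneSpan {D : Set P} {x : P} {c : ℝ} (hc : 0 ≤ c) (hx : x ∈ coneSpan D) :
    c • x ∈ coneSpan D := (coneSpan D).smul_mem ⟨c, hc⟩ hx

lemma convex_coneSpan (D : Set P) : Convex ℝ (coneSpan D : Set P) :=
  fun _ hx _ hy _ _ ha hb _ =>
    (coneSpan D).add_mem (smul_mem_coneSpan ha hx) (smul_mem_coneSpan hb hy)

lemma exists_sum_of_mem_coneSpan {D : Set P} (hD : ∀ c : ℝ, 0 ≤ c → ∀ x ∈ D, c • x ∈ D) {x : P}
    (hx : x ∈ coneSpan D) : ∃ (n : ℕ) (d : Fin n → P), (∀ i, d i ∈ D) ∧ x = ∑ i, d i := by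
  obtain ⟨n, c, g, rfl⟩ := Submodule.mem_span_set'.1 hx
  exact ⟨n, fun i => c i • (g i : P), fun i => hD _ (c i).2 _ (g i).2, rfl⟩

end Caratheodory

/-! ### Markov chains and output entropies -/

section Markov

variable {Ω A B B' C C' : Type*} [Fintype Ω] [Fintype A] [Fintype B] [Fintype B'] [Fintype C']
  [Fintype C]

/-- The law of the function `π` of the output of the channel `K` on the input law `v`. -/
def outLaw (K : Channel A B) (π : B → B') : (A → ℝ) →ₗ[ℝ] (B' → ℝ) where
  toFun v b := ∑ a, v a * prob (K a) π b
  map_add' v w := by ext b; simp [add_mul, Finset.sum_add_distrib]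
  map_smul' c v := by ext b; simp [mul_assoc, Finset.mul_sum]

lemma outLaw_apply (K : Channel A B) (π : B → B') (v : A → ℝ) (b : B') :
    outLaw K π v b = ∑ a, v a * prob (K a) π b := rfl

lemma outLaw_nonneg (K : Channel A B) (π : B → B') {v : A → ℝ} (hv : 0 ≤ v) : 0 ≤ outLaw K π v :=
  fun _ => Finset.sum_nonneg fun a _ => mul_nonneg (hv a) (prob_nonneg _ _ _)

/-- The (homogeneous) entropy of the output of the channel. -/
def outEntropy (K : Channel A B) (π : B → B') (v : A → ℝ) : ℝ := homEntropy (outLaw K π v)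

@[simp] lemma outEntropy_zero (K : Channel A B) (π : B → B') : outEntropy K π 0 = 0 := by
  simp [outEntropy]

lemma outEntropy_smul (K : Channel A B) (π : B → B') (c : ℝ) (v : A → ℝ) :
    outEntropy K π (c • v) = c * outEntropy K π v := by
  rw [outEntropy, map_smul, homEntropy_smul, outEntropy]

/-- The conditional entropy of the output of the channel given its input. -/
def noiseEntropy (K : Channel A B) (π : B → B') (v : A → ℝ) : ℝ :=
  ∑ a, v a * homEntropy (prob (K a) π)

lemma noiseEntropy_smul (K : Channel A B) (π : B → B') (c : ℝ) (v : A → ℝ) :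
    noiseEntropy K π (c • v) = c * noiseEntropy K π v := by
  simp [noiseEntropy, Finset.mul_sum, mul_assoc]

lemma noiseEntropy_sum {ι : Type*} (s : Finset ι) (K : Channel A B) (π : B → B') (v : ι → A → ℝ) :
    noiseEntropy K π (∑ i ∈ s, v i) = ∑ i ∈ s, noiseEntropy K π (v i) := by
  simp only [noiseEntropy, Finset.sum_apply, Finset.sum_mul]
  rw [Finset.sum_comm]

/-- `Z — X — Y` is a Markov chain, `Y` being the output of the channel `K` on the input `X`. -/
def IsMarkov (p : Distr Ω) (Z : Ω → C) (X : Ω → A) (Y : Ω → B) (K : Channel A B) : Prop :=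
  ∀ z a b, prob p (fun ω => ((Z ω, X ω), Y ω)) ((z, a), b) =
    prob p (fun ω => (Z ω, X ω)) (z, a) * K a b

variable {p : Distr Ω} {Z : Ω → C} {X : Ω → A} {Y : Ω → B} {K : Channel A B}

/-- The factor `K a b` does not depend on `z` and comes out of the sum over a fibre of `g`. -/
lemma IsMarkov.comp (h : IsMarkov p Z X Y K) (g : C → C') :
    IsMarkov p (fun ω => g (Z ω)) X Y K := by
  classical
  intro z a b
  rw [prob_comp p (fun ω => ((Z ω, X ω), Y ω)) (fun t => ((g t.1.1, t.1.2), t.2)),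
    prob_comp p (fun ω => (Z ω, X ω)) (fun t => (g t.1, t.2)), Fintype.sum_prod_type,
    Finset.sum_mul]
  refine Finset.sum_congr rfl fun t _ => ?_
  rw [Finset.sum_eq_single b]
  · obtain ⟨c, a'⟩ := t
    rw [h c a' b]
    by_cases hc : g c = z <;> by_cases ha : a' = a <;> simp [hc, ha]
  · intro b' _ hb; simp [hb]
  · simp

lemma IsMarkov.prob_output (h : IsMarkov p Z X Y K) (π : B → B') (b : B') (a : A) (z : C) :
    prob p (fun ω => (π (Y ω), X ω, Z ω)) (b, a, z) =
      prob p (fun ω => (Z ω, X ω)) (z, a) * prob (K a) π b := by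
  classical
  rw [prob_comp p (fun ω => ((Z ω, X ω), Y ω)) (fun t => (π t.2, t.1.2, t.1.1)),
    Fintype.sum_prod_type, Finset.sum_eq_single (z, a)]
  · rw [prob_eq (K a), Finset.mul_sum]
    refine Finset.sum_congr rfl fun b' _ => ?_
    by_cases hb : π b' = b <;> simp [hb, h z a b']
  · rintro ⟨z', a'⟩ - hne
    refine Finset.sum_eq_zero fun b' _ => if_neg ?_
    simp only [Prod.mk.injEq, ne_eq] at hne ⊢
    tauto
  · simp

lemma IsMarkov.prob_output' (h : IsMarkov p Z X Y K) (π : B → B') (b : B') (z : C) :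
    prob p (fun ω => (π (Y ω), Z ω)) (b, z) =
      outLaw K π (fun a => prob p (fun ω => (Z ω, X ω)) (z, a)) b := by
  classical
  rw [outLaw_apply, prob_comp p (fun ω => (π (Y ω), X ω, Z ω)) (fun t => (t.1, t.2.2)),
    Fintype.sum_prod_type, Finset.sum_eq_single b]
  · rw [Fintype.sum_prod_type]
    refine Finset.sum_congr rfl fun a _ => ?_
    rw [← h.prob_output]
    simp
  · intro b' _ hb; simp [hb]
  · simp

lemma IsMarkov.condEntropy_output (h : IsMarkov p Z X Y K) (π : B → B') :
    condEntropy p (fun ω => π (Y ω)) Z =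
      ∑ z, outEntropy K π (fun a => prob p (fun ω => (Z ω, X ω)) (z, a)) := by
  rw [condEntropy_eq_sum]
  refine Finset.sum_congr rfl fun z _ => congrArg _ (funext fun b => ?_)
  exact h.prob_output' π b z

/-- Given the input, `Z` is irrelevant, and what remains is linear in the input law alone. -/
lemma IsMarkov.condEntropy_output_input (h : IsMarkov p Z X Y K) (π : B → B') :
    condEntropy p (fun ω => π (Y ω)) (fun ω => (X ω, Z ω)) = noiseEntropy K π (prob p X) := by
  rw [condEntropy_eq_sum, noiseEntropy, Fintype.sum_prod_type]
  refine Finset.sum_congr rfl fun a _ => ?_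
  rw [← sum_prob_left p Z X a, Finset.sum_mul]
  refine Finset.sum_congr rfl fun z _ => ?_
  rw [← homEntropy_smul]
  refine congrArg _ (funext fun b => ?_)
  exact h.prob_output π b a z

lemma IsMarkov.entropy_output (h : IsMarkov p Z X Y K) (π : B → B') :
    entropy p (fun ω => π (Y ω)) = outEntropy K π (prob p X) := by
  rw [entropy_eq_homEntropy, outEntropy]
  congr 1
  ext b
  rw [← sum_prob_right p _ Z]
  simp only [h.prob_output', outLaw_apply]
  rw [Finset.sum_comm]
  refine Finset.sum_congr rfl fun a _ => ?_
  rw [← Finset.sum_mul, sum_prob_left]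

end Markov

/-! ### The cone of entropy vectors of test distributions -/

lemma family_eq_zero {C A : Type*} [Fintype C] {w : C → A → ℝ} (hw : 0 ≤ w)
    (h : ∑ c, w c = 0) : w = 0 := by
  rw [Finset.sum_eq_zero_iff_of_nonneg fun c _ => hw c] at h
  exact funext fun c => h c (Finset.mem_univ c)

section Cone

variable {A B₁ B₂ C₁ C₂ : Type*} [Fintype A] [Fintype B₁] [Fintype B₂] [Fintype C₁] [Fintype C₂]

/-- The space of (input law, conditional output entropies). -/
abbrev EntropySpace (A : Type*) : Type _ := ((A → ℝ) × (Fin 5 → ℝ)) × ℝ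

/-- The total output entropies `(H(B₁|C), H(B₂|C))` of a family of input laws. -/
def outPair (K : Channel A (B₁ × B₂)) (w : C₁ → A → ℝ) : ℝ × ℝ :=
  (∑ c, outEntropy K Prod.fst (w c), ∑ c, outEntropy K Prod.snd (w c))

/-- The entropy vector with input law `v` and conditional output entropies `y`, `z` given the
first and the second auxiliary variable. -/
def entropyPoint (K : Channel A (B₁ × B₂)) (v : A → ℝ) (y z : ℝ × ℝ) : EntropySpace A :=
  ((v, ![outEntropy K Prod.fst v, outEntropy K Prod.snd v, y.1, z.2, z.1]), y.2)

/-- The entropy vector of two refinements of the same input law. -/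
def fibrePoint (K : Channel A (B₁ × B₂)) (w₁ : C₁ → A → ℝ) (w₂ : C₂ → A → ℝ) : EntropySpace A :=
  entropyPoint K (∑ c, w₁ c) (outPair K w₁) (outPair K w₂)

/-- The entropy vectors of refinements with `n₁` and `n₂` letters. -/
def fibres (K : Channel A (B₁ × B₂)) (n₁ n₂ : ℕ) : Set (EntropySpace A) :=
  {x | ∃ (w₁ : Fin n₁ → A → ℝ) (w₂ : Fin n₂ → A → ℝ), 0 ≤ w₁ ∧ 0 ≤ w₂ ∧
    ∑ c, w₁ c = ∑ c, w₂ c ∧ x = fibrePoint K w₁ w₂}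

/-- The cone of the entropy vectors of all test distributions. -/
def entropyCone (K : Channel A (B₁ × B₂)) : Submodule ℝ≥0 (EntropySpace A) :=
  coneSpan (fibres K (Fintype.card A) (Fintype.card A))

variable (K : Channel A (B₁ × B₂))

lemma entropyPoint_convexComb_left {a b : ℝ} (hab : a + b = 1) (v : A → ℝ) (y y' z : ℝ × ℝ) :
    entropyPoint K v (a • y + b • y') z = a • entropyPoint K v y z + b • entropyPoint K v y' z := by
  obtain rfl : b = 1 - a := by linarith
  refine Prod.ext (Prod.ext ?_ ?_) ?_
  · simp [entropyPoint, ← add_smul]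
  · ext i
    fin_cases i <;> simp [entropyPoint] <;> ring
  · simp [entropyPoint]

lemma entropyPoint_convexComb_right {a b : ℝ} (hab : a + b = 1) (v : A → ℝ) (y z z' : ℝ × ℝ) :
    entropyPoint K v y (a • z + b • z') = a • entropyPoint K v y z + b • entropyPoint K v y z' := by
  obtain rfl : b = 1 - a := by linarith
  refine Prod.ext (Prod.ext ?_ ?_) ?_
  · simp [entropyPoint, ← add_smul]
  · ext i
    fin_cases i <;> simp [entropyPoint] <;> ring
  · simp [entropyPoint]; ring

lemma outPair_smul (c : ℝ) (w : C₁ → A → ℝ) : outPair K (c • w) = c • outPair K w := by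
  simp [outPair, outEntropy_smul, Finset.mul_sum]

lemma smul_fibrePoint (c : ℝ) (w₁ : C₁ → A → ℝ) (w₂ : C₂ → A → ℝ) :
    c • fibrePoint K w₁ w₂ = fibrePoint K (c • w₁) (c • w₂) := by
  simp only [fibrePoint, outPair_smul, Pi.smul_apply, ← Finset.smul_sum]
  refine Prod.ext (Prod.ext rfl ?_) rfl
  ext i
  fin_cases i <;> simp [entropyPoint, outEntropy_smul]

lemma fibrePoint_zero : fibrePoint K (0 : C₁ → A → ℝ) (0 : C₂ → A → ℝ) = 0 := by
  have := smul_fibrePoint K 0 (0 : C₁ → A → ℝ) (0 : C₂ → A → ℝ)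
  simpa using this.symm

lemma zero_mem_fibres (n₁ n₂ : ℕ) : (0 : EntropySpace A) ∈ fibres K n₁ n₂ :=
  ⟨0, 0, le_rfl, le_rfl, by simp, (fibrePoint_zero K).symm⟩

lemma smul_mem_fibres {n₁ n₂ : ℕ} (c : ℝ) (hc : 0 ≤ c) (x : EntropySpace A)
    (hx : x ∈ fibres K n₁ n₂) : c • x ∈ fibres K n₁ n₂ := by
  obtain ⟨w₁, w₂, h₁, h₂, h, rfl⟩ := hx
  exact ⟨c • w₁, c • w₂, smul_nonneg hc h₁, smul_nonneg hc h₂,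
    by simp [← Finset.smul_sum, h], smul_fibrePoint K c w₁ w₂⟩

/-- The total mass of an input law. -/
def mass (A : Type*) [Fintype A] : (A → ℝ) →ₗ[ℝ] ℝ := ∑ a, LinearMap.proj a

lemma mass_apply (v : A → ℝ) : mass A v = ∑ a, v a := by simp [mass]

lemma mass_nonneg {v : A → ℝ} (hv : 0 ≤ v) : 0 ≤ mass A v := by
  rw [mass_apply]; exact Finset.sum_nonneg fun a _ => hv a

lemma eq_zero_of_mass_eq_zero {v : A → ℝ} (hv : 0 ≤ v) (h : mass A v = 0) : v = 0 := by
  rw [mass_apply, Finset.sum_eq_zero_iff_of_nonneg fun a _ => hv a] at h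
  exact funext fun a => h a (Finset.mem_univ a)

lemma mass_fibre_nonneg {n₁ n₂ : ℕ} (x : EntropySpace A) (hx : x ∈ fibres K n₁ n₂) :
    0 ≤ mass A x.1.1 := by
  obtain ⟨w₁, w₂, h₁, h₂, h, rfl⟩ := hx
  exact mass_nonneg (v := ∑ c, w₁ c) (Finset.sum_nonneg fun c _ => h₁ c)

lemma fibre_eq_zero {n₁ n₂ : ℕ} (x : EntropySpace A) (hx : x ∈ fibres K n₁ n₂)
    (h0 : mass A x.1.1 = 0) : x = 0 := by
  obtain ⟨w₁, w₂, h₁, h₂, h, rfl⟩ := hx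
  have hv := eq_zero_of_mass_eq_zero (v := ∑ c, w₁ c) (Finset.sum_nonneg fun c _ => h₁ c) h0
  rw [family_eq_zero h₁ hv, family_eq_zero h₂ (h ▸ hv)]
  exact fibrePoint_zero K

lemma sum_law_outPair (w : C₁ → A → ℝ) :
    ∑ c, ((w c, outEntropy K Prod.fst (w c), outEntropy K Prod.snd (w c)) :
      (A → ℝ) × ℝ × ℝ) = (∑ c, w c, outPair K w) := by
  refine Prod.ext ?_ (Prod.ext ?_ ?_) <;> simp [Prod.fst_sum, Prod.snd_sum, outPair]

/-- Every refinement of an input law is a mixture of refinements with `|A|` letters. -/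
lemma outPair_mem_convexHull (w : C₁ → A → ℝ) (hw : 0 ≤ w) :
    outPair K w ∈ convexHull ℝ {y | ∃ w' : Fin (Fintype.card A) → A → ℝ,
      0 ≤ w' ∧ ∑ c, w' c = ∑ c, w c ∧ y = outPair K w'} := by
  let φ : (A → ℝ) → (A → ℝ) × (ℝ × ℝ) :=
    fun v => (v, outEntropy K Prod.fst v, outEntropy K Prod.snd v)
  have key := sum_mem_convexHull_small (D := {x | ∃ v, 0 ≤ v ∧ x = φ v})
    ⟨0, le_rfl, by simp only [φ, outEntropy_zero]; rfl⟩
    (by rintro c hc _ ⟨v, hv, rfl⟩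
        exact ⟨c • v, smul_nonneg hc hv, by simp [φ, outEntropy_smul]⟩)
    (LinearMap.fst ℝ (A → ℝ) (ℝ × ℝ)) (mass A)
    (by rintro _ ⟨v, hv, rfl⟩; exact mass_nonneg (v := v) hv)
    (by rintro _ ⟨v, hv, rfl⟩ h
        have : v = 0 := eq_zero_of_mass_eq_zero hv h
        simp [φ, this])
    (fun c => φ (w c)) (fun c => ⟨w c, hw c, rfl⟩)
    (N := Fintype.card A) (by simp)
  have h2 := Set.mem_image_of_mem (LinearMap.snd ℝ (A → ℝ) (ℝ × ℝ)) key
  rw [LinearMap.image_convexHull, sum_law_outPair] at h2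
  refine convexHull_mono ?_ h2
  rintro _ ⟨_, ⟨hx, d, hd, rfl⟩, rfl⟩
  choose u hu hud using hd
  obtain rfl : d = fun c => φ (u c) := funext hud
  rw [sum_law_outPair] at hx ⊢
  exact ⟨u, hu, hx, rfl⟩

/-- For a fixed law, the vector is affine in the entropies of either refinement separately. Each
refinement is replaced in turn by a mixture of refinements with `|A|` letters, and the cone is
convex. -/
lemma fibrePoint_mem_entropyCone (w₁ : C₁ → A → ℝ) (w₂ : C₂ → A → ℝ) (h₁ : 0 ≤ w₁) (h₂ : 0 ≤ w₂)
    (h : ∑ c, w₁ c = ∑ c, w₂ c) : fibrePoint K w₁ w₂ ∈ entropyCone K := by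
  have conv := convex_coneSpan (fibres K (Fintype.card A) (Fintype.card A))
  have step : ∀ z ∈ {y | ∃ w' : Fin (Fintype.card A) → A → ℝ,
      0 ≤ w' ∧ ∑ c, w' c = ∑ c, w₂ c ∧ y = outPair K w'},
      entropyPoint K (∑ c, w₁ c) (outPair K w₁) z ∈ entropyCone K := by
    rintro _ ⟨u₂, hu₂, hs₂, rfl⟩
    refine convexHull_min (t := {y | entropyPoint K (∑ c, w₁ c) y (outPair K u₂) ∈ entropyCone K})
      ?_ ?_ (outPair_mem_convexHull K w₁ h₁)
    · rintro _ ⟨u₁, hu₁, hs₁, rfl⟩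
      refine Submodule.subset_span ⟨u₁, u₂, hu₁, hu₂, ?_, ?_⟩
      · rw [hs₁, hs₂, h]
      · rw [fibrePoint, hs₁]
    · intro y hy y' hy' a b ha hb hab
      rw [Set.mem_ofPred_eq, entropyPoint_convexComb_left K hab]
      exact conv hy hy' ha hb hab
  refine convexHull_min (t := {z | entropyPoint K (∑ c, w₁ c) (outPair K w₁) z ∈ entropyCone K})
    step ?_ (outPair_mem_convexHull K w₂ h₂)
  intro y hy y' hy' a b ha hb hab
  rw [Set.mem_ofPred_eq, entropyPoint_convexComb_right K hab]
  exact conv hy hy' ha hb hab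

/-- The ten information quantities as functions of the entropy vector. -/
def infoBounds (x : EntropySpace A) : Fin 10 → ℝ :=
  let e₁ := outEntropy K Prod.fst x.1.1
  let e₂ := outEntropy K Prod.snd x.1.1
  let n₁ := noiseEntropy K Prod.fst x.1.1
  let n₂ := noiseEntropy K Prod.snd x.1.1
  let h := x.1.2
  ![e₁ - h 0, e₂ - h 1, e₁ - h 2, e₂ - h 3, e₁ - h 0 + (h 1 - h 3), e₂ - h 1 + (h 0 - h 2),
    e₁ - h 2 + (x.2 - n₂), e₂ - h 3 + (h 4 - n₁), e₁ - h 0 + (h 1 - h 3) + (h 4 - n₁),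
    e₂ - h 1 + (h 0 - h 2) + (x.2 - n₂)]

/-- The last coordinate, H(B₂|C₀C₁), occurs only with a plus sign. This is why it is stored apart
and costs no letter of V₀. -/
lemma infoBounds_mono {x y : EntropySpace A} (h : x.1 = y.1) (h' : x.2 ≤ y.2) :
    infoBounds K x ≤ infoBounds K y := by
  intro j
  fin_cases j <;> simp [infoBounds, h, h']

/-- The output entropies are nonlinear in the law, but the law is the same in both vectors;
everything else is linear. -/
lemma infoBounds_convexComb {x y : EntropySpace A} (h : x.1.1 = y.1.1) {a b : ℝ}
    (hab : a + b = 1) :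
    infoBounds K (a • x + b • y) = a • infoBounds K x + b • infoBounds K y := by
  have e : (a • x + b • y).1.1 = x.1.1 := by
    simp [← h, ← add_smul, hab]
  obtain rfl : b = 1 - a := by linarith
  ext j
  simp only [infoBounds, e]
  fin_cases j <;> simp [← h] <;> ring

end Cone

/-! ### Entropy vectors of auxiliary random variables -/

section AuxiliaryVariables

variable {Ω A B₁ B₂ C₀ C₁ C₂ : Type*} [Fintype Ω] [Fintype A] [Fintype B₁] [Fintype B₂]
  [Fintype C₀] [Fintype C₁] [Fintype C₂]

/-- The input law and the conditional output entropies of a triple of auxiliary variables. -/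
def auxPoint (p : Distr Ω) (U₀ : Ω → C₀) (U₁ : Ω → C₁) (U₂ : Ω → C₂) (X : Ω → A)
    (Y : Ω → B₁ × B₂) : EntropySpace A :=
  ((prob p X, ![condEntropy p (fun ω => (Y ω).1) U₀, condEntropy p (fun ω => (Y ω).2) U₀,
    condEntropy p (fun ω => (Y ω).1) (fun ω => (U₀ ω, U₁ ω)),
    condEntropy p (fun ω => (Y ω).2) (fun ω => (U₀ ω, U₂ ω)),
    condEntropy p (fun ω => (Y ω).1) (fun ω => (U₀ ω, U₂ ω))]),
    condEntropy p (fun ω => (Y ω).2) (fun ω => (U₀ ω, U₁ ω)))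

/-- The sub-law of `(C, X)` on the event `U = u`. -/
def fibreLaw {D : Type*} [Fintype D] (p : Distr Ω) (U : Ω → C₀) (V : Ω → D) (X : Ω → A) (u : C₀)
    (c : D) (a : A) : ℝ :=
  prob p (fun ω => ((U ω, V ω), X ω)) ((u, c), a)

lemma fibreLaw_eq {D : Type*} [Fintype D] (p : Distr Ω) (U : Ω → C₀) (V : Ω → D) (X : Ω → A)
    (u : C₀) (c : D) :
    fibreLaw p U V X u c = fun a => prob p (fun ω => ((U ω, V ω), X ω)) ((u, c), a) := rfl

lemma sum_fibreLaw {D : Type*} [Fintype D] (p : Distr Ω) (U : Ω → C₀) (V : Ω → D) (X : Ω → A)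
    (u : C₀) : ∑ c, fibreLaw p U V X u c = fun a => prob p (fun ω => (U ω, X ω)) (u, a) := by
  classical
  ext a
  rw [Finset.sum_apply, prob_comp p (fun ω => ((U ω, V ω), X ω)) (fun t => (t.1.1, t.2)),
    Fintype.sum_prod_type, Fintype.sum_prod_type, Finset.sum_eq_single u]
  · refine Finset.sum_congr rfl fun c _ => ?_
    rw [Finset.sum_eq_single a]
    · simp [fibreLaw]
    · intro a' _ ha; simp [ha]
    · simp
  · intro u' _ hu
    simp [hu]
  · simp

variable {p : Distr Ω} {U₀ : Ω → C₀} {U₁ : Ω → C₁} {U₂ : Ω → C₂} {X : Ω → A}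
  {Y : Ω → B₁ × B₂} {K : Channel A (B₁ × B₂)}

/-- Each conditional entropy splits over the values `u` of `U₀`, and the input law is the sum of its
sub-laws on these events. -/
lemma auxPoint_eq_sum (h : IsMarkov p (fun ω => (U₀ ω, U₁ ω, U₂ ω)) X Y K) :
    auxPoint p U₀ U₁ U₂ X Y =
      ∑ u, fibrePoint K (fibreLaw p U₀ U₁ X u) (fibreLaw p U₀ U₂ X u) := by
  have m0 : IsMarkov p U₀ X Y K := h.comp Prod.fst
  have m1 : IsMarkov p (fun ω => (U₀ ω, U₁ ω)) X Y K := h.comp fun t => (t.1, t.2.1)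
  have m2 : IsMarkov p (fun ω => (U₀ ω, U₂ ω)) X Y K := h.comp fun t => (t.1, t.2.2)
  refine Prod.ext (Prod.ext ?_ ?_) ?_
  · simp only [auxPoint, fibrePoint, entropyPoint, Prod.fst_sum, sum_fibreLaw]
    ext a
    rw [Finset.sum_apply, sum_prob_left]
  · simp only [Prod.fst_sum, Prod.snd_sum, auxPoint]
    ext i
    rw [Finset.sum_apply]
    fin_cases i
    · simpa [fibrePoint, entropyPoint, sum_fibreLaw] using m0.condEntropy_output Prod.fst
    · simpa [fibrePoint, entropyPoint, sum_fibreLaw] using m0.condEntropy_output Prod.snd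
    · simpa [fibrePoint, entropyPoint, outPair, fibreLaw_eq, Fintype.sum_prod_type] using
        m1.condEntropy_output Prod.fst
    · simpa [fibrePoint, entropyPoint, outPair, fibreLaw_eq, Fintype.sum_prod_type] using
        m2.condEntropy_output Prod.snd
    · simpa [fibrePoint, entropyPoint, outPair, fibreLaw_eq, Fintype.sum_prod_type] using
        m2.condEntropy_output Prod.fst
  · simp only [Prod.snd_sum, auxPoint]
    simpa [fibrePoint, entropyPoint, outPair, fibreLaw_eq, Fintype.sum_prod_type] using
        m1.condEntropy_output Prod.snd

theorem auxPoint_mem_entropyCone (h : IsMarkov p (fun ω => (U₀ ω, U₁ ω, U₂ ω)) X Y K) :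
    auxPoint p U₀ U₁ U₂ X Y ∈ entropyCone K := by
  rw [auxPoint_eq_sum h]
  refine Submodule.sum_mem _ fun u _ => fibrePoint_mem_entropyCone K _ _
    (fun c a => prob_nonneg _ _ _) (fun c a => prob_nonneg _ _ _) ?_
  rw [sum_fibreLaw, sum_fibreLaw]

end AuxiliaryVariables

/-! ### Entropy vectors and test channels -/

section TestChannels

variable {A B B₁ B₂ C C₀ C₁ C₂ : Type*} [Fintype A] [Fintype B] [Fintype B₁] [Fintype B₂]
  [Fintype C] [Fintype C₀] [Fintype C₁] [Fintype C₂]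

/-- A joint law with marginal `p` is given by a channel. -/
lemma exists_channel_of_joint [Nonempty C] (p : Distr A) (w : A → C → ℝ) (hw : ∀ a c, 0 ≤ w a c)
    (hs : ∀ a, ∑ c, w a c = p a) : ∃ θ : Channel A C, ∀ a c, θ a c * p a = w a c := by
  have : ∀ a, ∃ q : Distr C, ∀ c, q c * p a = w a c := by
    intro a
    -- Where `p a = 0` the whole row of `w` vanishes and any law will do.
    by_cases ha : p a = 0
    · obtain ⟨q⟩ : Nonempty (Distr C) := inferInstance
      refine ⟨q, fun c => ?_⟩
      have := (Finset.sum_eq_zero_iff_of_nonneg (fun c _ => hw a c)).1 ((hs a).trans ha) c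
        (Finset.mem_univ c)
      rw [this, ha, mul_zero]
    · have hpos : 0 < p a := lt_of_le_of_ne (p.2.1 a) (Ne.symm ha)
      refine ⟨⟨fun c => w a c / p a, fun c => div_nonneg (hw a c) hpos.le, ?_⟩, fun c => ?_⟩
      · rw [← Finset.sum_div, hs, div_self ha]
      · exact div_mul_cancel₀ _ ha
  choose θ hθ using this
  exact ⟨θ, hθ⟩

lemma prob_eq_apply {Ω : Type*} [Fintype Ω] (p : Distr Ω) {X : Ω → A} (hX : Function.Injective X)
    (ω : Ω) : prob p X (X ω) = p ω := by
  classical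
  rw [prob_eq, Finset.sum_eq_single ω]
  · simp
  · intro ω' _ h; rw [if_neg fun e => h (hX e)]
  · simp

variable (θ : Channel A (C₀ × C₁ × C₂)) (p : Distr A) (K : Channel A (B₁ × B₂))

lemma joint_apply (ω : (C₀ × C₁ × C₂) × A × (B₁ × B₂)) :
    joint θ p K ω = θ ω.2.1 ω.1 * p ω.2.1 * K ω.2.1 ω.2.2 := rfl

lemma prob_joint (c : C₀ × C₁ × C₂) (a : A) (b : B₁ × B₂) :
    prob (joint θ p K) (fun ω => ((ω.1, ω.2.1), ω.2.2)) ((c, a), b) = θ a c * p a * K a b :=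
  prob_eq_apply (joint θ p K) (X := fun ω => ((ω.1, ω.2.1), ω.2.2))
    (fun ω ω' h => by simpa [Prod.ext_iff, and_assoc] using h) (c, a, b)

lemma prob_joint_input (c : C₀ × C₁ × C₂) (a : A) :
    prob (joint θ p K) (fun ω => (ω.1, ω.2.1)) (c, a) = θ a c * p a := by
  rw [← sum_prob_right (joint θ p K) _ (fun ω => ω.2.2)]
  simp only [prob_joint, ← Finset.mul_sum]
  rw [show ∑ b, K a b = 1 from (K a).2.2, mul_one]

lemma isMarkov_joint :
    IsMarkov (joint θ p K) (fun ω => (ω.1.1, ω.1.2.1, ω.1.2.2)) (fun ω => ω.2.1)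
      (fun ω => ω.2.2) K := fun c a b => by
  rw [prob_joint_input θ p K c a]
  exact prob_joint θ p K c a b

lemma prob_joint_letter : prob (joint θ p K) (fun ω => ω.2.1) = p := by
  ext a
  rw [← sum_prob_left (joint θ p K) (fun ω => ω.1)]
  simp only [prob_joint_input, ← Finset.sum_mul]
  rw [show ∑ c, θ a c = 1 from (θ a).2.2, one_mul]

/-- The entropy vector of a test channel. -/
def channelPoint : EntropySpace A :=
  auxPoint (joint θ p K) (fun ω => ω.1.1) (fun ω => ω.1.2.1) (fun ω => ω.1.2.2) (fun ω => ω.2.1)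
    (fun ω => ω.2.2)

lemma channelPoint_mem : channelPoint θ p K ∈ entropyCone K :=
  auxPoint_mem_entropyCone (isMarkov_joint θ p K)

lemma channelPoint_law : (channelPoint θ p K).1.1 = p := prob_joint_letter θ p K

lemma measurements_eq : measurements θ p K = infoBounds K (channelPoint θ p K) := by
  have m := isMarkov_joint θ p K
  have m1 : IsMarkov (joint θ p K) (fun ω => (ω.1.1, ω.1.2.1)) (fun ω => ω.2.1)
      (fun ω => ω.2.2) K := m.comp fun t => (t.1, t.2.1)
  have m2 : IsMarkov (joint θ p K) (fun ω => (ω.1.1, ω.1.2.2)) (fun ω => ω.2.1)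
      (fun ω => ω.2.2) K := m.comp fun t => (t.1, t.2.2)
  have e1 := m.entropy_output Prod.fst
  have e2 := m.entropy_output Prod.snd
  have n1 := m2.condEntropy_output_input Prod.fst
  have n2 := m1.condEntropy_output_input Prod.snd
  have s2 : condEntropy (joint θ p K) (fun ω => ω.2.2.2) (fun ω => (ω.1.2.2, ω.1.1)) =
      condEntropy (joint θ p K) (fun ω => ω.2.2.2) (fun ω => (ω.1.1, ω.1.2.2)) :=
    condEntropy_congr _ (fun ω ω' => by simp only [Prod.mk.injEq]; tauto)
      (fun ω ω' => by simp only [Prod.mk.injEq]; tauto)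
  have s3 : condEntropy (joint θ p K) (fun ω => ω.2.2.1) (fun ω => (ω.1.2.1, ω.1.1)) =
      condEntropy (joint θ p K) (fun ω => ω.2.2.1) (fun ω => (ω.1.1, ω.1.2.1)) :=
    condEntropy_congr _ (fun ω ω' => by simp only [Prod.mk.injEq]; tauto)
      (fun ω ω' => by simp only [Prod.mk.injEq]; tauto)
  ext j
  fin_cases j <;>
    simp [measurements, infoBounds, mutualInfo_eq, condMutualInfo_eq, channelPoint, auxPoint,
      e1, e2, n1, n2, s2, s3]

lemma fibreLaw_joint_one (u : C₀) (c : C₁) (a : A) :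
    fibreLaw (joint θ p K) (fun ω => ω.1.1) (fun ω => ω.1.2.1) (fun ω => ω.2.1) u c a =
      ∑ c₂, θ a (u, c, c₂) * p a := by
  classical
  rw [fibreLaw, prob_comp (joint θ p K) (fun ω => (ω.1, ω.2.1))
    (fun t => ((t.1.1, t.1.2.1), t.2)), Fintype.sum_prod_type_right, Finset.sum_eq_single a,
    Fintype.sum_prod_type, Finset.sum_eq_single u, Fintype.sum_prod_type, Finset.sum_eq_single c]
  · simp [prob_joint_input]
  · intro c' _ h; simp [h]
  · simp
  · intro u' _ h; simp [h]
  · simp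
  · intro a' _ h; simp [h]
  · simp

lemma fibreLaw_joint_two (u : C₀) (c : C₂) (a : A) :
    fibreLaw (joint θ p K) (fun ω => ω.1.1) (fun ω => ω.1.2.2) (fun ω => ω.2.1) u c a =
      ∑ c₁, θ a (u, c₁, c) * p a := by
  classical
  rw [fibreLaw, prob_comp (joint θ p K) (fun ω => (ω.1, ω.2.1))
    (fun t => ((t.1.1, t.1.2.2), t.2)), Fintype.sum_prod_type_right, Finset.sum_eq_single a,
    Fintype.sum_prod_type, Finset.sum_eq_single u, Fintype.sum_prod_type_right,
    Finset.sum_eq_single c]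
  · simp [prob_joint_input]
  · intro c' _ h; simp [h]
  · simp
  · intro u' _ h; simp [h]
  · simp
  · intro a' _ h; simp [h]
  · simp

lemma Distr.nonempty (p : Distr A) : Nonempty A := by
  by_contra h
  rw [not_nonempty_iff] at h
  have : ∑ a, p a = 1 := p.2.2
  simp at this

variable {p K} in
/-- Refinements are realised by a test channel in which the two auxiliary variables are
conditionally independent. -/
theorem exists_channel_of_fibres {n : ℕ} (hn : 0 < n) (d : Fin n → EntropySpace A)
    (hd : ∀ i, d i ∈ fibres K (Fintype.card A) (Fintype.card A)) (hp : (∑ i, d i).1.1 = p) :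
    ∃ θ : Channel A (Fin n × Fin (Fintype.card A) × Fin (Fintype.card A)),
      channelPoint θ p K = ∑ i, d i := by
  choose w₁ w₂ h₁ h₂ h hdw using hd
  obtain rfl : d = fun i => fibrePoint K (w₁ i) (w₂ i) := funext hdw
  have : Nonempty A := p.nonempty
  have : NeZero n := ⟨hn.ne'⟩
  have : NeZero (Fintype.card A) := ⟨Fintype.card_ne_zero⟩
  have hv₁ : ∀ i a, ∑ c, w₁ i c a = (∑ c, w₁ i c) a := fun i a => by simp
  have hv₂ : ∀ i a, ∑ c, w₂ i c a = (∑ c, w₁ i c) a := fun i a => by rw [h]; simp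
  have hv0 : ∀ i a, 0 ≤ (∑ c, w₁ i c) a := fun i a => by
    rw [← hv₁]; exact Finset.sum_nonneg fun c _ => h₁ i c a
  have hz₁ : ∀ i a c, (∑ c, w₁ i c) a = 0 → w₁ i c a = 0 := fun i a c h0 => by
    rw [← hv₁, Finset.sum_eq_zero_iff_of_nonneg fun c _ => h₁ i c a] at h0
    exact h0 c (Finset.mem_univ c)
  have hz₂ : ∀ i a c, (∑ c, w₁ i c) a = 0 → w₂ i c a = 0 := fun i a c h0 => by
    rw [← hv₂, Finset.sum_eq_zero_iff_of_nonneg fun c _ => h₂ i c a] at h0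
    exact h0 c (Finset.mem_univ c)
  have m₁ : ∀ i a c₁, ∑ c₂, w₁ i c₁ a * w₂ i c₂ a / (∑ c, w₁ i c) a = w₁ i c₁ a := by
    intro i a c₁
    rw [← Finset.sum_div, ← Finset.mul_sum, hv₂]
    exact mul_div_cancel_of_imp (hz₁ i a c₁)
  have m₂ : ∀ i a c₂, ∑ c₁, w₁ i c₁ a * w₂ i c₂ a / (∑ c, w₁ i c) a = w₂ i c₂ a := by
    intro i a c₂
    rw [← Finset.sum_div, ← Finset.sum_mul, hv₁, mul_comm]
    exact mul_div_cancel_of_imp (hz₂ i a c₂)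
  -- The coupling makes the two refinements independent given the first variable and the letter.
  -- Where the denominator vanishes so do `w₁` and `w₂`, so the convention x/0 = 0 leaves the
  -- marginals correct.
  obtain ⟨θ, hθ⟩ := exists_channel_of_joint p
    (fun a (c : Fin n × Fin (Fintype.card A) × Fin (Fintype.card A)) =>
      w₁ c.1 c.2.1 a * w₂ c.1 c.2.2 a / (∑ c', w₁ c.1 c') a)
    (fun a c => div_nonneg (mul_nonneg (h₁ _ _ _) (h₂ _ _ _)) (hv0 _ _))
    (fun a => by
      simp only [Fintype.sum_prod_type, m₁, hv₁]
      rw [← hp]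
      simp [Prod.fst_sum, fibrePoint, entropyPoint])
  refine ⟨θ, ?_⟩
  rw [channelPoint, auxPoint_eq_sum (isMarkov_joint θ p K)]
  refine Finset.sum_congr rfl fun i _ => ?_
  congr 1
  · ext c a
    rw [fibreLaw_joint_one]
    simp only [hθ, m₁]
  · ext c a
    rw [fibreLaw_joint_two]
    simp only [hθ, m₂]

variable {p K} in
/-- Entropy vectors are dominated by test channels with small alphabets. -/
theorem exists_channel_ge {x : EntropySpace A} (hx : x ∈ entropyCone K) (hp : x.1.1 = p) :
    ∃ θ : Channel A (Fin (Fintype.card A + 5) × Fin (Fintype.card A) × Fin (Fintype.card A)),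
      infoBounds K x ≤ measurements θ p K := by
  obtain ⟨n, d, hd, rfl⟩ := exists_sum_of_mem_coneSpan (smul_mem_fibres K) hx
  -- The law and five entropies are preserved, a space of dimension `|A| + 5`; the sixth entropy
  -- then serves as the objective, and some generator does not decrease it.
  have key := sum_mem_convexHull_small (zero_mem_fibres K _ _) (smul_mem_fibres K)
    (LinearMap.fst ℝ ((A → ℝ) × (Fin 5 → ℝ)) ℝ) (mass A ∘ₗ LinearMap.fst ℝ (A → ℝ) (Fin 5 → ℝ))
    (mass_fibre_nonneg K) (fibre_eq_zero K) d hd (N := Fintype.card A + 5) (by simp)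
  obtain ⟨y, ⟨hy, d', hd', rfl⟩, hle⟩ :=
    exists_le_of_mem_convexHull key (LinearMap.snd ℝ ((A → ℝ) × (Fin 5 → ℝ)) ℝ)
  simp only [LinearMap.fst_apply, LinearMap.snd_apply] at hy hle
  obtain ⟨θ, hθ⟩ := exists_channel_of_fibres (p := p) (Nat.succ_pos _) d' hd' (by rw [hy, hp])
  exact ⟨θ, by rw [measurements_eq, hθ]; exact infoBounds_mono K hy.symm hle⟩

variable {p K} in
/-- Entropy vectors are mixtures of those of test channels with alphabets of the size of the
input alphabet. -/
theorem mem_convexHull_channelPoint {x : EntropySpace A} (hx : x ∈ entropyCone K)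
    (hp : x.1.1 = p) :
    x ∈ convexHull ℝ {y | ∃ θ : Channel A
      (Fin (Fintype.card A) × Fin (Fintype.card A) × Fin (Fintype.card A)),
      channelPoint θ p K = y} := by
  obtain ⟨n, d, hd, rfl⟩ := exists_sum_of_mem_coneSpan (smul_mem_fibres K) hx
  -- Only the law is preserved, so `|A|` summands suffice; the six entropies are reproduced by the
  -- mixture.
  have key := sum_mem_convexHull_small (zero_mem_fibres K _ _) (smul_mem_fibres K)
    (LinearMap.fst ℝ (A → ℝ) (Fin 5 → ℝ) ∘ₗ LinearMap.fst ℝ ((A → ℝ) × (Fin 5 → ℝ)) ℝ) (mass A)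
    (mass_fibre_nonneg K) (fibre_eq_zero K) d hd (N := Fintype.card A) (by simp)
  refine convexHull_mono ?_ key
  rintro _ ⟨hy, d', hd', rfl⟩
  have : Nonempty A := p.nonempty
  exact exists_channel_of_fibres Fintype.card_pos d' hd' (hy.trans hp)

end TestChannels

/-! ### The channel side of the converse -/

section Window

variable {Ω D Y₁ Y₂ : Type*} {n : ℕ}

lemma forall_lt_succ {n : ℕ} (q : Fin n) (P : Fin n → Prop) :
    (∀ i : Fin n, i.1 < q.1 + 1 → P i) ↔ P q ∧ ∀ i : Fin n, i.1 < q.1 → P i := by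
  refine ⟨fun h => ⟨h q (by omega), fun i hi => h i (by omega)⟩, fun h i hi => ?_⟩
  rcases eq_or_ne i q with rfl | hne
  · exact h.1
  · exact h.2 i (by have := Fin.val_ne_of_ne hne; omega)

lemma forall_ge_succ {n : ℕ} (q : Fin n) (P : Fin n → Prop) :
    (∀ i : Fin n, q.1 ≤ i.1 → P i) ↔ P q ∧ ∀ i : Fin n, q.1 + 1 ≤ i.1 → P i := by
  refine ⟨fun h => ⟨h q le_rfl, fun i hi => h i (by omega)⟩, fun h i hi => ?_⟩
  rcases eq_or_ne i q with rfl | hne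
  · exact h.1
  · exact h.2 i (by have := Fin.val_ne_of_ne hne; omega)

lemma sum_fin_telescope (F : ℕ → ℝ) (n : ℕ) : ∑ q : Fin n, (F (q.1 + 1) - F q.1) = F n - F 0 := by
  rw [Fin.sum_univ_eq_sum_range (fun i => F (i + 1) - F i) n, Finset.sum_range_sub]

/-- The variable `V` together with the first outputs before time `a` and the second outputs from
time `b` on. -/
def window (V : Ω → D) (Y : Ω → Fin n → Y₁ × Y₂) (a b : ℕ) (ω : Ω) :
    D × ({i : Fin n // i.1 < a} → Y₁) × ({i : Fin n // b ≤ i.1} → Y₂) :=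
  (V ω, fun i => (Y ω i).1, fun i => (Y ω i).2)

lemma window_eq_iff (V : Ω → D) (Y : Ω → Fin n → Y₁ × Y₂) (a b : ℕ) (ω ω' : Ω) :
    window V Y a b ω = window V Y a b ω' ↔ V ω = V ω' ∧
      (∀ i : Fin n, i.1 < a → (Y ω i).1 = (Y ω' i).1) ∧
      ∀ i : Fin n, b ≤ i.1 → (Y ω i).2 = (Y ω' i).2 := by
  simp [window, funext_iff]

end Window

/-! ### Csiszár sum identity and single-letter bounds for the channel outputs -/

section ChannelSide

variable {Ω D C₀ C₁ C₂ M X Y₁ Y₂ : Type*} [Fintype Ω] [Fintype D] [Fintype C₀] [Fintype C₁]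
  [Fintype C₂] [Fintype M] [Fintype X] [Fintype Y₁] [Fintype Y₂] {n : ℕ}

/-- The ten information quantities of arbitrary random variables. -/
def infoVector (p : Distr Ω) (c₀ : Ω → C₀) (c₁ : Ω → C₁) (c₂ : Ω → C₂) (a : Ω → M) (b₁ : Ω → Y₁)
    (b₂ : Ω → Y₂) : Fin 10 → ℝ :=
  let c₀₁ : Ω → C₀ × C₁ := fun ω => (c₀ ω, c₁ ω)
  let c₀₂ : Ω → C₀ × C₂ := fun ω => (c₀ ω, c₂ ω)
  ![mutualInfo p c₀ b₁,
    mutualInfo p c₀ b₂,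
    mutualInfo p c₀₁ b₁,
    mutualInfo p c₀₂ b₂,
    mutualInfo p c₀ b₁ + condMutualInfo p c₂ b₂ c₀,
    mutualInfo p c₀ b₂ + condMutualInfo p c₁ b₁ c₀,
    mutualInfo p c₀₁ b₁ + condMutualInfo p a b₂ c₀₁,
    mutualInfo p c₀₂ b₂ + condMutualInfo p a b₁ c₀₂,
    mutualInfo p c₀ b₁ + condMutualInfo p c₂ b₂ c₀ + condMutualInfo p a b₁ c₀₂,
    mutualInfo p c₀ b₂ + condMutualInfo p c₁ b₁ c₀ + condMutualInfo p a b₂ c₀₁]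

variable (p : Distr Ω) (V : Ω → D) (Y : Ω → Fin n → Y₁ × Y₂)

/-- Joining the first output at time `q` moves the left end of the window from `q` to `q + 1`, so
sums over time telescope. -/
lemma condEntropy_window_fst (q : Fin n) (b : ℕ) :
    condEntropy p (fun ω => (Y ω q).1) (window V Y q b) =
      entropy p (window V Y (q + 1) b) - entropy p (window V Y q b) := by
  rw [condEntropy]
  congr 1
  refine entropy_congr p fun ω ω' => ?_
  rw [Prod.mk.injEq, window_eq_iff, window_eq_iff, forall_lt_succ]
  tauto

lemma condEntropy_window_snd (q : Fin n) (a : ℕ) :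
    condEntropy p (fun ω => (Y ω q).2) (window V Y a (q + 1)) =
      entropy p (window V Y a q) - entropy p (window V Y a (q + 1)) := by
  rw [condEntropy]
  congr 1
  refine entropy_congr p fun ω ω' => ?_
  rw [Prod.mk.injEq, window_eq_iff, window_eq_iff, forall_ge_succ]
  tauto

lemma entropy_window_empty : entropy p (window V Y 0 n) = entropy p V :=
  entropy_congr p fun ω ω' => by
    rw [window_eq_iff]
    exact ⟨fun h => h.1, fun h => ⟨h, fun i hi => absurd hi (by omega),
      fun i hi => absurd hi (by omega)⟩⟩

lemma condEntropy_fst_eq_window : condEntropy p (fun ω q => (Y ω q).1) V =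
    entropy p (window V Y n n) - entropy p (window V Y 0 n) := by
  rw [entropy_window_empty, condEntropy]
  congr 1
  refine entropy_congr p fun ω ω' => ?_
  rw [window_eq_iff, Prod.mk.injEq, funext_iff]
  exact ⟨fun h => ⟨h.2, fun i _ => h.1 i, fun i hi => absurd hi (by omega)⟩,
    fun h => ⟨fun i => h.2.1 i i.2, h.1⟩⟩

lemma condEntropy_snd_eq_window : condEntropy p (fun ω q => (Y ω q).2) V =
    entropy p (window V Y 0 0) - entropy p (window V Y 0 n) := by
  rw [entropy_window_empty, condEntropy]
  congr 1
  refine entropy_congr p fun ω ω' => ?_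
  rw [window_eq_iff, Prod.mk.injEq, funext_iff]
  exact ⟨fun h => ⟨h.2, fun i hi => absurd hi (by omega), fun i _ => h.1 i⟩,
    fun h => ⟨fun i => h.2.2 i (Nat.zero_le _), h.1⟩⟩

/-- The Csiszár sum identity. -/
lemma sum_condEntropy_window_sub :
    ∑ q : Fin n, condEntropy p (fun ω => (Y ω q).1) (window V Y q (q + 1)) -
      ∑ q : Fin n, condEntropy p (fun ω => (Y ω q).2) (window V Y q (q + 1)) =
    condEntropy p (fun ω q => (Y ω q).1) V - condEntropy p (fun ω q => (Y ω q).2) V := by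
  -- With F(a,b) the entropy of the window, the right side is F(n,n) − F(0,0). It is telescoped
  -- along the diagonal, each diagonal step passing through F(q,q+1).
  rw [condEntropy_fst_eq_window, condEntropy_snd_eq_window, sub_sub_sub_cancel_right,
    ← sum_fin_telescope fun k => entropy p (window V Y k k), ← Finset.sum_sub_distrib]
  refine Finset.sum_congr rfl fun q _ => ?_
  rw [condEntropy_window_fst, condEntropy_window_snd]
  ring

/-- The chain rule conditions on the past of the first output only; the future of the second output,
also in the window, can only lower each term. -/
lemma sum_condEntropy_window_fst_le :
    ∑ q : Fin n, condEntropy p (fun ω => (Y ω q).1) (window V Y q (q + 1)) ≤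
      condEntropy p (fun ω q => (Y ω q).1) V := by
  rw [condEntropy_fst_eq_window, ← sum_fin_telescope fun k => entropy p (window V Y k n)]
  refine Finset.sum_le_sum fun q _ => ?_
  rw [← condEntropy_window_fst]
  refine condEntropy_anti p _ fun ω ω' h => ?_
  rw [window_eq_iff] at h ⊢
  exact ⟨h.1, h.2.1, fun i hi => absurd hi (by omega)⟩

lemma sum_condEntropy_window_snd_le :
    ∑ q : Fin n, condEntropy p (fun ω => (Y ω q).2) (window V Y q (q + 1)) ≤
      condEntropy p (fun ω q => (Y ω q).2) V := by
  have := sum_fin_telescope (fun k => -entropy p (window V Y 0 k)) n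
  rw [condEntropy_snd_eq_window, show entropy p (window V Y 0 0) - entropy p (window V Y 0 n) =
    -entropy p (window V Y 0 n) - -entropy p (window V Y 0 0) by ring, ← this]
  refine Finset.sum_le_sum fun q _ => ?_
  rw [neg_sub_neg, ← condEntropy_window_snd]
  refine condEntropy_anti p _ fun ω ω' h => ?_
  rw [window_eq_iff] at h ⊢
  exact ⟨h.1, fun i hi => absurd hi (by omega), h.2.2⟩

/-- Chain rule, dropping the other coordinates from each condition. -/
lemma condEntropy_pi_le {E : Type*} [Fintype E] {m : ℕ} (Z : Fin m → Ω → E) :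
    condEntropy p (fun ω t => Z t ω) V ≤ ∑ t, condEntropy p (Z t) V := by
  induction m with
  | zero =>
    rw [condEntropy, entropy_congr p (Y := V) (fun ω ω' => by
      simp only [Prod.mk.injEq, and_iff_right_iff_imp]
      exact fun _ => Subsingleton.elim _ _)]
    simp
  | succ m ih =>
    rw [Fin.sum_univ_succ]
    have h1 : condEntropy p (fun ω t => Z t ω) V =
        condEntropy p (Z 0) (fun ω => ((fun t : Fin m => Z t.succ ω), V ω)) +
          condEntropy p (fun ω (t : Fin m) => Z t.succ ω) V := by
      rw [condEntropy, condEntropy, condEntropy, sub_add_sub_cancel]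
      congr 1
      refine entropy_congr p fun ω ω' => ?_
      simp only [Prod.mk.injEq, funext_iff, Fin.forall_fin_succ, and_assoc]
    rw [h1]
    refine add_le_add (condEntropy_anti p _ fun ω ω' h => ?_) (ih _)
    exact (Prod.mk.inj h).2

lemma entropy_pi_le {E : Type*} [Fintype E] {m : ℕ} (Z : Fin m → Ω → E) :
    entropy p (fun ω t => Z t ω) ≤ ∑ t, entropy p (Z t) := by
  simpa only [condEntropy_unit] using condEntropy_pi_le p (fun _ => ()) Z

/-- The entropy vector at time `q` of a block code; the common auxiliary variable is joined by the
past of the first and the future of the second output. -/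
def letterPoint (V₀ : Ω → C₀) (V₁ : Ω → C₁) (V₂ : Ω → C₂) (x : Ω → Fin n → X) (q : Fin n) :
    EntropySpace X :=
  auxPoint p (window V₀ Y q (q + 1)) V₁ V₂ (fun ω => x ω q) (fun ω => Y ω q)

variable {p Y} {V₀ : Ω → C₀} {V₁ : Ω → C₁} {V₂ : Ω → C₂} {μ : Ω → M} {x : Ω → Fin n → X}
  {W : Channel X (Y₁ × Y₂)}

/-- Everything but the output at time `q` depends on that output only through the input. -/
def IsMemoryless (p : Distr Ω) (V₀ : Ω → C₀) (V₁ : Ω → C₁) (V₂ : Ω → C₂) (μ : Ω → M)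
    (x : Ω → Fin n → X) (Y : Ω → Fin n → Y₁ × Y₂) (W : Channel X (Y₁ × Y₂)) : Prop :=
  ∀ q, IsMarkov p (fun ω => ((V₀ ω, V₁ ω, V₂ ω, μ ω), fun i : {i : Fin n // i ≠ q} => Y ω i))
    (fun ω => x ω q) (fun ω => Y ω q) W

/-- The window omits both outputs at time `q`, so it is a function of the variables that the
memoryless property allows. -/
lemma IsMemoryless.isMarkov_window (h : IsMemoryless p V₀ V₁ V₂ μ x Y W) (q : Fin n)
    (g : C₀ × C₁ × C₂ × M → D) :
    IsMarkov p (window (fun ω => g (V₀ ω, V₁ ω, V₂ ω, μ ω)) Y q (q + 1)) (fun ω => x ω q)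
      (fun ω => Y ω q) W := by
  have hlt : ∀ i : {i : Fin n // i.1 < q.1}, i.1 ≠ q := fun i e => by have := i.2; omega
  have hgt : ∀ i : {i : Fin n // q.1 + 1 ≤ i.1}, i.1 ≠ q := fun i e => by have := i.2; omega
  have key := (h q).comp fun t => ((g t.1, fun i => (t.2 ⟨i.1, hlt i⟩).1,
    fun i => (t.2 ⟨i.1, hgt i⟩).2) :
      D × ({i : Fin n // i.1 < q.1} → Y₁) × ({i : Fin n // q.1 + 1 ≤ i.1} → Y₂))
  exact key

lemma IsMemoryless.letterPoint_mem (h : IsMemoryless p V₀ V₁ V₂ μ x Y W) (q : Fin n) :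
    letterPoint p Y V₀ V₁ V₂ x q ∈ entropyCone W :=
  auxPoint_mem_entropyCone <|
    (h.isMarkov_window q fun t => (t.1, t.2.1, t.2.2.1)).comp
      fun t => ((t.1.1, t.2), t.1.2.1, t.1.2.2)

lemma condEntropy_window_pair {E : Type*} [Fintype E] (V : Ω → D) (V' : Ω → C₁) (Z : Ω → E)
    (q : Fin n) :
    condEntropy p Z (fun ω => (window V Y q (q + 1) ω, V' ω)) =
      condEntropy p Z (window (fun ω => (V ω, V' ω)) Y q (q + 1)) := by
  refine condEntropy_congr p (fun ω ω' => ?_) fun ω ω' => ?_ <;>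
  · simp only [window_eq_iff, Prod.mk.injEq]
    tauto

/-- Given the message, the block of outputs has at least the entropy of the channel noise. -/
lemma IsMemoryless.noise_fst_le (h : IsMemoryless p V₀ V₁ V₂ μ x Y W) (g : C₀ × C₁ × C₂ × M → D) :
    ∑ q, noiseEntropy W Prod.fst (prob p fun ω => x ω q) ≤
      condEntropy p (fun ω q => (Y ω q).1) (fun ω => (μ ω, g (V₀ ω, V₁ ω, V₂ ω, μ ω))) := by
  refine le_trans (Finset.sum_le_sum fun q _ => ?_) (sum_condEntropy_window_fst_le p _ Y)
  -- Adding the input at time `q` to the window lowers the entropy to that of the noise.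
  rw [← (h.isMarkov_window q fun t => (t.2.2.2, g t)).condEntropy_output_input Prod.fst]
  exact condEntropy_anti p _ fun ω ω' e => (Prod.mk.inj e).2

lemma IsMemoryless.noise_snd_le (h : IsMemoryless p V₀ V₁ V₂ μ x Y W) (g : C₀ × C₁ × C₂ × M → D) :
    ∑ q, noiseEntropy W Prod.snd (prob p fun ω => x ω q) ≤
      condEntropy p (fun ω q => (Y ω q).2) (fun ω => (μ ω, g (V₀ ω, V₁ ω, V₂ ω, μ ω))) := by
  refine le_trans (Finset.sum_le_sum fun q _ => ?_) (sum_condEntropy_window_snd_le p _ Y)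
  rw [← (h.isMarkov_window q fun t => (t.2.2.2, g t)).condEntropy_output_input Prod.snd]
  exact condEntropy_anti p _ fun ω ω' e => (Prod.mk.inj e).2

/-- Subadditivity over time, then concavity in the input law. The laws are summed, not averaged, so
no time-sharing variable is needed. -/
lemma IsMemoryless.entropy_block_le {Y' : Type*} [Fintype Y'] (h : IsMemoryless p V₀ V₁ V₂ μ x Y W)
    (π : Y₁ × Y₂ → Y') :
    entropy p (fun ω q => π (Y ω q)) ≤ outEntropy W π (∑ q, prob p fun ω => x ω q) := by
  refine (entropy_pi_le p fun q ω => π (Y ω q)).trans ?_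
  simp only [fun q => (h q).entropy_output π, outEntropy, map_sum]
  exact sum_homEntropy_le _ fun q => outLaw_nonneg _ _ (prob_nonneg' _ _)

/-- The multi-letter information quantities are bounded by those of the entropy vector
accumulated over time. -/
theorem IsMemoryless.infoVector_le (h : IsMemoryless p V₀ V₁ V₂ μ x Y W) (j : Fin 10) :
    infoVector p V₀ V₁ V₂ μ (fun ω q => (Y ω q).1) (fun ω q => (Y ω q).2) j ≤
      infoBounds W (∑ q, letterPoint p Y V₀ V₁ V₂ x q) j := by
  have law : (∑ q, letterPoint p Y V₀ V₁ V₂ x q).1.1 = ∑ q, prob p fun ω => x ω q := by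
    simp [Prod.fst_sum, letterPoint, auxPoint]
  have e1 := h.entropy_block_le Prod.fst
  have e2 := h.entropy_block_le Prod.snd
  have n1 := h.noise_fst_le fun t => (t.1, t.2.2.1)
  have n2 := h.noise_snd_le fun t => (t.1, t.2.1)
  -- Differences of the two outputs' entropies under one condition are exact by the Csiszár identity
  -- (`c0`, `c1`, `c2`). Unpaired negative terms are bounded by the chain rule (`a0`, `b0`, `a1`,
  -- `b2`), those conditioned on the message by the noise (`n1`, `n2`).
  have c0 := sum_condEntropy_window_sub p V₀ Y
  have c1 := sum_condEntropy_window_sub p (fun ω => (V₀ ω, V₁ ω)) Y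
  have c2 := sum_condEntropy_window_sub p (fun ω => (V₀ ω, V₂ ω)) Y
  have a0 := sum_condEntropy_window_fst_le p V₀ Y
  have b0 := sum_condEntropy_window_snd_le p V₀ Y
  have a1 := sum_condEntropy_window_fst_le p (fun ω => (V₀ ω, V₁ ω)) Y
  have b2 := sum_condEntropy_window_snd_le p (fun ω => (V₀ ω, V₂ ω)) Y
  have s2 : condEntropy p (fun ω q => (Y ω q).2) (fun ω => (V₂ ω, V₀ ω)) =
      condEntropy p (fun ω q => (Y ω q).2) (fun ω => (V₀ ω, V₂ ω)) :=
    condEntropy_congr p (fun ω ω' => by simp only [Prod.mk.injEq]; tauto)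
      (fun ω ω' => by simp only [Prod.mk.injEq]; tauto)
  have s1 : condEntropy p (fun ω q => (Y ω q).1) (fun ω => (V₁ ω, V₀ ω)) =
      condEntropy p (fun ω q => (Y ω q).1) (fun ω => (V₀ ω, V₁ ω)) :=
    condEntropy_congr p (fun ω ω' => by simp only [Prod.mk.injEq]; tauto)
      (fun ω ω' => by simp only [Prod.mk.injEq]; tauto)
  rw [infoBounds, law]
  fin_cases j <;>
    simp [infoVector, mutualInfo_eq, condMutualInfo_eq, letterPoint, auxPoint, Prod.fst_sum,
      Prod.snd_sum, condEntropy_window_pair, noiseEntropy_sum, s1, s2] <;>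
    linarith

end ChannelSide

/-! ### The law of a block code -/

section Products

variable {Ω A B D R : Type*} [Fintype Ω] [Fintype A] [Fintype B] [Fintype D] [Fintype R] {m n : ℕ}

lemma sum_pi_prod (k : Fin m → B → ℝ) : ∑ z : Fin m → B, ∏ t, k t (z t) = ∏ t, ∑ b, k t b := by
  rw [Finset.prod_univ_sum, Fintype.piFinset_univ]

lemma sum_pi_prod_distr (k : Fin m → Distr B) : ∑ z : Fin m → B, ∏ t, k t (z t) = 1 := by
  rw [sum_pi_prod fun t => k t]
  exact Finset.prod_eq_one fun t _ => (k t).2.2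

/-- The entropy of an i.i.d. block. -/
lemma sum_negMulLog_prod (k : B → ℝ) (hk : ∑ b, k b = 1) :
    ∑ z : Fin m → B, negMulLog (∏ t, k (z t)) = m * ∑ b, negMulLog (k b) := by
  induction m with
  | zero => simp
  | succ m ih =>
    rw [← (Fin.consEquiv fun _ => B).sum_comp, Fintype.sum_prod_type]
    have h1 : ∑ z : Fin m → B, ∏ t, k (z t) = 1 := by
      rw [sum_pi_prod fun _ => k]; simp [hk]
    simp only [Fin.consEquiv_apply, Fin.prod_univ_succ, Fin.cons_zero, Fin.cons_succ,
      negMulLog_mul, Finset.sum_add_distrib, ← Finset.sum_mul, ← Finset.mul_sum, h1, hk, ih]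
    push_cast
    ring

/-- The bijection makes `(z, b)` a coordinate system on `Ω`: each event is a single atom or empty,
and the factorisation of the mass is the Markov property. -/
lemma isMarkov_of_factor (p : Distr Ω) (Z : Ω → R) (Y : Ω → B) (x : R → A) (K : Channel A B)
    (ρ : R → ℝ) (hb : Function.Bijective fun ω => (Z ω, Y ω))
    (hp : ∀ ω, p ω = ρ (Z ω) * K (x (Z ω)) (Y ω)) :
    IsMarkov p Z (fun ω => x (Z ω)) Y K := by
  classical
  have h1 : ∀ z a b, prob p (fun ω => ((Z ω, x (Z ω)), Y ω)) ((z, a), b) =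
      (if x z = a then ρ z else 0) * K a b := by
    intro z a b
    obtain ⟨ω, hω⟩ := hb.2 (z, b)
    obtain ⟨rfl, rfl⟩ := Prod.mk.inj hω
    by_cases ha : x (Z ω) = a
    · subst ha
      rw [if_pos rfl, ← hp]
      refine prob_eq_apply p (X := fun ω => ((Z ω, x (Z ω)), Y ω)) (fun ω₁ ω₂ h => ?_) ω
      simp only [Prod.mk.injEq] at h
      exact hb.1 (Prod.ext h.1.1 h.2)
    · rw [if_neg ha, zero_mul, prob_eq]
      refine Finset.sum_eq_zero fun ω' _ => if_neg fun h => ha ?_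
      simp only [Prod.mk.injEq] at h
      rw [← h.1.1, h.1.2]
  intro z a b
  rw [h1, ← sum_prob_right p (fun ω => (Z ω, x (Z ω))) Y (z, a)]
  simp only [h1, ← Finset.mul_sum]
  rw [show ∑ b, K a b = 1 from (K a).2.2, mul_one]

end Products

section Code

variable {S X Y₁ Y₂ C D : Type*} [Fintype S] [Fintype Y₁] [Fintype Y₂] [Fintype C]
  [Fintype D] {m n : ℕ}

/-- The joint law of the source block and the block of channel outputs. -/
def blockLaw (pS : Distr S) (W : Channel X (Y₁ × Y₂)) (f : (Fin m → S) → (Fin n → X)) :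
    Distr ((Fin m → S) × (Fin n → Y₁ × Y₂)) :=
  ⟨fun ω => blockProb pS W f ω.1 ω.2, fun ω => mul_nonneg
    (Finset.prod_nonneg fun t _ => pS.2.1 _) (Finset.prod_nonneg fun q _ => (W _).2.1 _), by
      rw [Fintype.sum_prod_type]
      simp only [blockProb, ← Finset.mul_sum]
      simp only [fun s => sum_pi_prod_distr fun q => W (f s q), mul_one]
      exact sum_pi_prod_distr fun _ => pS⟩

/-- The joint law of the test variables, the source block and the block of channel outputs. -/
def codeLaw (θ : Channel S C) (pS : Distr S) (W : Channel X (Y₁ × Y₂))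
    (f : (Fin m → S) → (Fin n → X)) :
    Distr ((Fin m → C) × (Fin m → S) × (Fin n → Y₁ × Y₂)) :=
  ⟨fun ω => (∏ t, θ (ω.2.1 t) (ω.1 t)) * blockLaw pS W f ω.2, fun ω => mul_nonneg
    (Finset.prod_nonneg fun t _ => (θ _).2.1 _) ((blockLaw pS W f).2.1 _), by
      rw [Fintype.sum_prod_type_right]
      simp only [← Finset.sum_mul]
      simp only [fun s : Fin m → S => sum_pi_prod_distr fun t => θ (s t), one_mul]
      exact (blockLaw pS W f).2.2⟩

variable (θ : Channel S C) (pS : Distr S) (W : Channel X (Y₁ × Y₂)) (f : (Fin m → S) → (Fin n → X))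

lemma blockLaw_apply (ω : (Fin m → S) × (Fin n → Y₁ × Y₂)) :
    blockLaw pS W f ω = (∏ t, pS (ω.1 t)) * ∏ q, W (f ω.1 q) (ω.2 q) := rfl

lemma codeLaw_apply (ω : (Fin m → C) × (Fin m → S) × (Fin n → Y₁ × Y₂)) :
    codeLaw θ pS W f ω = (∏ t, θ (ω.2.1 t) (ω.1 t)) * blockLaw pS W f ω.2 := rfl

/-- The test variables sum out, so the law of source and outputs does not depend on `θ`; this lets
the virtual channel and the input law be fixed before the test. -/
lemma prob_codeLaw_block (g : (Fin m → S) × (Fin n → Y₁ × Y₂) → D) :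
    prob (codeLaw θ pS W f) (fun ω => g ω.2) = prob (blockLaw pS W f) g := by
  classical
  ext d
  rw [prob_eq, prob_eq, Fintype.sum_prod_type_right]
  refine Finset.sum_congr rfl fun ω _ => ?_
  split_ifs
  · simp only [codeLaw_apply, ← Finset.sum_mul]
    rw [sum_pi_prod_distr fun t => θ (ω.1 t), one_mul]
  · simp

lemma prob_codeLaw_letters (u : Fin m → C) (s : Fin m → S) :
    prob (codeLaw θ pS W f) (fun ω => (ω.1, ω.2.1)) (u, s) = ∏ t, θ (s t) (u t) * pS (s t) := by
  rw [← sum_prob_right (codeLaw θ pS W f) (fun ω => (ω.1, ω.2.1)) (fun ω => ω.2.2)]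
  have : ∀ y, prob (codeLaw θ pS W f) (fun ω => ((ω.1, ω.2.1), ω.2.2)) ((u, s), y) =
      codeLaw θ pS W f (u, s, y) := fun y =>
    prob_eq_apply (codeLaw θ pS W f) (X := fun ω => ((ω.1, ω.2.1), ω.2.2))
      (fun ω ω' h => by simpa [Prod.ext_iff, and_assoc] using h) (u, s, y)
  simp only [this, codeLaw_apply, blockLaw_apply, ← Finset.mul_sum]
  rw [sum_pi_prod_distr fun q => W (f s q), mul_one, Finset.prod_mul_distrib]

/-- Letterwise functions of the test variables and the source are i.i.d. -/
lemma prob_codeLaw_iid (g : C × S → D) (d : Fin m → D) :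
    prob (codeLaw θ pS W f) (fun ω t => g (ω.1 t, ω.2.1 t)) d =
      ∏ t, ∑ z : C × S, θ z.2 z.1 * pS z.2 * (open Classical in if g z = d t then 1 else 0) := by
  classical
  rw [prob_comp (codeLaw θ pS W f) (fun ω => (ω.1, ω.2.1)) (fun z t => g (z.1 t, z.2 t)),
    ← sum_pi_prod fun t (z : C × S) => θ z.2 z.1 * pS z.2 * (if g z = d t then 1 else 0),
    ← (Equiv.arrowProdEquivProdArrow (Fin m) (fun _ => C) (fun _ => S)).sum_comp]
  refine Finset.sum_congr rfl fun z _ => ?_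
  simp only [Equiv.arrowProdEquivProdArrow, Equiv.coe_fn_mk, prob_codeLaw_letters, mul_ite, mul_one,
    mul_zero, Finset.prod_ite_zero, funext_iff, Finset.mem_univ, forall_true_left]

lemma isMarkov_codeLaw_channel [Fintype X] (q : Fin n) :
    IsMarkov (codeLaw θ pS W f)
      (fun ω => ((ω.1, ω.2.1), fun i : {i : Fin n // i ≠ q} => ω.2.2 i))
      (fun ω => f ω.2.1 q) (fun ω => ω.2.2 q) W := by
  refine isMarkov_of_factor (codeLaw θ pS W f)
    (fun ω => ((ω.1, ω.2.1), fun i : {i : Fin n // i ≠ q} => ω.2.2 i)) (fun ω => ω.2.2 q)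
    (fun z => f z.1.2 q) W
    (fun z => (∏ t, θ (z.1.2 t) (z.1.1 t)) * (∏ t, pS (z.1.2 t)) *
      ∏ i : {i : Fin n // i ≠ q}, W (f z.1.2 i) (z.2 i)) ⟨?_, ?_⟩ ?_
  · rintro ⟨u, s, y⟩ ⟨u', s', y'⟩ h
    simp only [Prod.mk.injEq, funext_iff, Subtype.forall] at h ⊢
    refine ⟨h.1.1.1, h.1.1.2, fun i => ?_⟩
    by_cases hi : i = q
    · rw [hi]; exact h.2
    · exact h.1.2 i hi
  · rintro ⟨⟨⟨u, s⟩, r⟩, b⟩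
    refine ⟨(u, s, (Equiv.funSplitAt q (Y₁ × Y₂)).symm (b, r)), ?_⟩
    simp only [Prod.mk.injEq, true_and, Equiv.funSplitAt_symm_apply, dite_true, and_true]
    ext1 i
    simp [i.2]
  · intro ω
    rw [codeLaw_apply, blockLaw_apply, Fintype.prod_eq_mul_prod_subtype_ne _ q]
    ring

lemma isMarkov_codeLaw_source (t : Fin m) :
    IsMarkov (codeLaw θ pS W f) (fun ω => ω.2) (fun ω => ω.2.1 t) (fun ω => ω.1 t) θ := by
  -- The other test letters are first included so that the outcome is determined, and then
  -- forgotten.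
  have key : IsMarkov (codeLaw θ pS W f) (fun ω => (ω.2, fun i : {i : Fin m // i ≠ t} => ω.1 i))
      (fun ω => ω.2.1 t) (fun ω => ω.1 t) θ := by
    refine isMarkov_of_factor (codeLaw θ pS W f)
      (fun ω => (ω.2, fun i : {i : Fin m // i ≠ t} => ω.1 i)) (fun ω => ω.1 t) (fun z => z.1.1 t) θ
      (fun z => (∏ i : {i : Fin m // i ≠ t}, θ (z.1.1 i) (z.2 i)) * blockLaw pS W f z.1)
      ⟨?_, ?_⟩ ?_
    · rintro ⟨u, s⟩ ⟨u', s'⟩ h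
      simp only [Prod.mk.injEq, funext_iff, Subtype.forall] at h ⊢
      refine ⟨fun i => ?_, h.1.1⟩
      by_cases hi : i = t
      · rw [hi]; exact h.2
      · exact h.1.2 i hi
    · rintro ⟨⟨s, r⟩, b⟩
      refine ⟨((Equiv.funSplitAt t C).symm (b, r), s), ?_⟩
      simp only [Prod.mk.injEq, true_and, Equiv.funSplitAt_symm_apply, dite_true, and_true]
      ext1 i
      simp [i.2]
    · intro ω
      rw [codeLaw_apply, Fintype.prod_eq_mul_prod_subtype_ne _ t]
      ring
  exact key.comp Prod.fst

end Code

/-! ### The source side of the converse -/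

section SourceSide

variable {S T₁ T₂ X Y₁ Y₂ C₀ C₁ C₂ : Type*} [Fintype S] [Fintype T₁] [Fintype T₂]
  [Fintype Y₁] [Fintype Y₂] [Fintype C₀] [Fintype C₁] [Fintype C₂] {m n : ℕ}

/-- The pair of reconstructions of the `t`-th source letter. -/
def reconstruction (g₁ : (Fin n → Y₁) → (Fin m → T₁)) (g₂ : (Fin n → Y₂) → (Fin m → T₂))
    (t : Fin m) (y : Fin n → Y₁ × Y₂) : T₁ × T₂ :=
  (g₁ (fun q => (y q).1) t, g₂ (fun q => (y q).2) t)

/-- `Q` is the virtual broadcast channel from a uniformly chosen source letter to its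
reconstructions. -/
def IsVirtualChannel (Q : Channel S (T₁ × T₂)) (pS : Distr S) (W : Channel X (Y₁ × Y₂))
    (f : (Fin m → S) → (Fin n → X)) (g₁ : (Fin n → Y₁) → (Fin m → T₁))
    (g₂ : (Fin n → Y₂) → (Fin m → T₂)) : Prop :=
  ∀ s r, (m : ℝ) * (Q s r * pS s) =
    ∑ t, prob (blockLaw pS W f) (fun ω => (reconstruction g₁ g₂ t ω.2, ω.1 t)) (r, s)

lemma prob_blockLaw_letter (pS : Distr S) (W : Channel X (Y₁ × Y₂)) (f : (Fin m → S) → (Fin n → X))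
    (t : Fin m) (s : S) : prob (blockLaw pS W f) (fun ω => ω.1 t) s = pS s := by
  classical
  rw [prob_eq, Fintype.sum_prod_type]
  -- The indicator of `z t = s` is written as a product over all times, to let the sum over blocks
  -- factor.
  have h1 : ∀ z : Fin m → S, (∑ y, if z t = s then blockLaw pS W f (z, y) else 0) =
      ∏ i, (pS (z i) * if i = t then (if z i = s then 1 else 0) else 1) := by
    intro z
    rw [Finset.prod_mul_distrib,
      Finset.prod_ite_eq' Finset.univ t fun i => if z i = s then (1 : ℝ) else 0]
    simp only [Finset.mem_univ, if_true, blockLaw_apply, mul_ite, mul_one, mul_zero]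
    split_ifs
    · rw [← Finset.mul_sum, sum_pi_prod_distr fun q => W (f z q), mul_one]
    · simp
  simp only [h1]
  rw [sum_pi_prod fun i b => pS b * if i = t then (if b = s then 1 else 0) else 1,
    Finset.prod_eq_single t]
  · simp
  · intro i _ hi
    simp only [hi, if_false, mul_one]
    exact pS.2.2
  · simp

lemma exists_virtualChannel (hm : 0 < m) (pS : Distr S) (W : Channel X (Y₁ × Y₂))
    (f : (Fin m → S) → (Fin n → X)) (g₁ : (Fin n → Y₁) → (Fin m → T₁))
    (g₂ : (Fin n → Y₂) → (Fin m → T₂)) : ∃ Q, IsVirtualChannel Q pS W f g₁ g₂ := by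
  have hm' : (0 : ℝ) < m := Nat.cast_pos.2 hm
  obtain ⟨⟨-, y⟩⟩ := (blockLaw pS W f).nonempty
  have : Nonempty (T₁ × T₂) := ⟨reconstruction g₁ g₂ ⟨0, hm⟩ y⟩
  obtain ⟨Q, hQ⟩ := exists_channel_of_joint pS
    (fun s r => (1 / (m : ℝ)) * ∑ t, prob (blockLaw pS W f)
      (fun ω => (reconstruction g₁ g₂ t ω.2, ω.1 t)) (r, s))
    (fun s r => mul_nonneg (by positivity) (Finset.sum_nonneg fun t _ => prob_nonneg _ _ _))
    (fun s => by
      rw [← Finset.mul_sum, Finset.sum_comm]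
      simp only [sum_prob_left, prob_blockLaw_letter]
      simp [hm'.ne'])
  refine ⟨Q, fun s r => ?_⟩
  rw [hQ]
  field_simp

variable {Q : Channel S (T₁ × T₂)} {pS : Distr S} {W : Channel X (Y₁ × Y₂)}
  {f : (Fin m → S) → (Fin n → X)} {g₁ : (Fin n → Y₁) → (Fin m → T₁)}
  {g₂ : (Fin n → Y₂) → (Fin m → T₂)}

lemma IsVirtualChannel.sum_eq (hQ : IsVirtualChannel Q pS W f g₁ g₂) (v : S → T₁ × T₂ → ℝ) :
    (m : ℝ) * ∑ s, ∑ r, pS s * Q s r * v s r =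
      ∑ t : Fin m, ∑ s : Fin m → S, ∑ y : Fin n → Y₁ × Y₂,
        blockProb pS W f s y * v (s t) (reconstruction g₁ g₂ t y) := by
  have h1 : ∀ t, ∑ s : Fin m → S, ∑ y : Fin n → Y₁ × Y₂,
        blockProb pS W f s y * v (s t) (reconstruction g₁ g₂ t y) = ∑ s, ∑ r,
        prob (blockLaw pS W f) (fun ω => (reconstruction g₁ g₂ t ω.2, ω.1 t)) (r, s) * v s r := by
    intro t
    have := sum_prob_mul (blockLaw pS W f) (fun ω => (reconstruction g₁ g₂ t ω.2, ω.1 t))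
      (fun z => v z.2 z.1)
    rw [Fintype.sum_prod_type_right, Fintype.sum_prod_type] at this
    exact this.symm
  simp only [h1, Finset.mul_sum]
  symm
  rw [Finset.sum_comm]
  refine Finset.sum_congr rfl fun s _ => ?_
  rw [Finset.sum_comm]
  refine Finset.sum_congr rfl fun r _ => ?_
  rw [← Finset.sum_mul, ← hQ]
  ring

lemma IsVirtualChannel.distortion₁_eq (hm : 0 < m) (hQ : IsVirtualChannel Q pS W f g₁ g₂)
    (w : S → T₁ → ℝ≥0) : distortion₁ pS Q w =
      blockDistortion pS W f (fun y => g₁ (fun q => (y q).1)) w := by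
  have hm' : (m : ℝ) ≠ 0 := Nat.cast_ne_zero.2 hm.ne'
  have := hQ.sum_eq fun s r => (w s r.1 : ℝ)
  rw [blockDistortion, distortion₁, one_div, eq_inv_mul_iff_mul_eq₀ hm', this]
  rfl

lemma IsVirtualChannel.distortion₂_eq (hm : 0 < m) (hQ : IsVirtualChannel Q pS W f g₁ g₂)
    (w : S → T₂ → ℝ≥0) : distortion₂ pS Q w =
      blockDistortion pS W f (fun y => g₂ (fun q => (y q).2)) w := by
  have hm' : (m : ℝ) ≠ 0 := Nat.cast_ne_zero.2 hm.ne'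
  have := hQ.sum_eq fun s r => (w s r.2 : ℝ)
  rw [blockDistortion, distortion₂, one_div, eq_inv_mul_iff_mul_eq₀ hm', this]
  rfl

variable (θ : Channel S (C₀ × C₁ × C₂))

/-- The single-letter test law is the average over time of the law in the code. -/
lemma IsVirtualChannel.prob_joint_eq {D : Type*} [Fintype D]
    (hQ : IsVirtualChannel Q pS W f g₁ g₂) (F : (C₀ × C₁ × C₂) × S × (T₁ × T₂) → D) (d : D) :
    (m : ℝ) * prob (joint θ pS Q) F d = ∑ t, prob (codeLaw θ pS W f)
      (fun ω => F (ω.1 t, ω.2.1 t, reconstruction g₁ g₂ t ω.2.2)) d := by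
  classical
  have h1 : ∀ ω, (m : ℝ) * joint θ pS Q ω = ∑ t, prob (codeLaw θ pS W f)
      (fun ω => (ω.1 t, ω.2.1 t, reconstruction g₁ g₂ t ω.2.2)) ω := by
    rintro ⟨c, s, r⟩
    -- The reconstruction depends on the outputs only, and the test letter at time `t` is
    -- conditionally independent of them given the source letter.
    have h2 : ∀ t, prob (codeLaw θ pS W f)
        (fun ω => (ω.1 t, ω.2.1 t, reconstruction g₁ g₂ t ω.2.2)) (c, s, r) =
        prob (blockLaw pS W f) (fun ω => (reconstruction g₁ g₂ t ω.2, ω.1 t)) (r, s) * θ s c := by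
      intro t
      have mk : IsMarkov (codeLaw θ pS W f) (fun ω => reconstruction g₁ g₂ t ω.2.2)
          (fun ω => ω.2.1 t) (fun ω => ω.1 t) θ :=
        (isMarkov_codeLaw_source θ pS W f t).comp fun z => reconstruction g₁ g₂ t z.2
      have := mk.prob_output id c s r
      rw [← prob_codeLaw_block θ pS W f]
      refine this.trans ?_
      rw [show prob (θ s) id c = θ s c from prob_eq_apply (θ s) Function.injective_id c]
    simp only [h2, ← Finset.sum_mul]
    rw [← hQ, joint_apply]
    ring
  have h3 : ∀ t, prob (codeLaw θ pS W f)
      (fun ω => F (ω.1 t, ω.2.1 t, reconstruction g₁ g₂ t ω.2.2)) d =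
      ∑ z, if F z = d then prob (codeLaw θ pS W f)
        (fun ω => (ω.1 t, ω.2.1 t, reconstruction g₁ g₂ t ω.2.2)) z else 0 := fun t =>
    prob_comp (codeLaw θ pS W f) (fun ω => (ω.1 t, ω.2.1 t, reconstruction g₁ g₂ t ω.2.2)) F d
  simp only [h3]
  rw [prob_eq, Finset.mul_sum, Finset.sum_comm]
  refine Finset.sum_congr rfl fun z _ => ?_
  by_cases hz : F z = d
  · simp [hz, h1]
  · simp [hz]

/-- The pairs of test and source letters are i.i.d. The hypothesis is on partitions, so `A` may be
any repackaging of the block, such as a tuple of blocks. -/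
lemma entropy_codeLaw_iid {D E : Type*} [Fintype D] [Fintype E] (Q : Channel S (T₁ × T₂))
    (a : (C₀ × C₁ × C₂) × S → D)
    {A : (Fin m → C₀ × C₁ × C₂) × (Fin m → S) × (Fin n → Y₁ × Y₂) → E}
    (hA : ∀ ω ω', A ω = A ω' ↔ ∀ t, a (ω.1 t, ω.2.1 t) = a (ω'.1 t, ω'.2.1 t)) :
    entropy (codeLaw θ pS W f) A = m * entropy (joint θ pS Q) (fun ω => a (ω.1, ω.2.1)) := by
  classical
  rw [entropy_congr (codeLaw θ pS W f) (Y := fun ω t => a (ω.1 t, ω.2.1 t))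
    (by simpa only [funext_iff] using hA), entropy_eq, entropy_eq,
    ← sum_negMulLog_prod _ (sum_prob _ _)]
  refine Finset.sum_congr rfl fun d _ => congrArg _ ?_
  rw [prob_codeLaw_iid θ pS W f a d]
  refine Finset.prod_congr rfl fun t _ => ?_
  rw [prob_comp (joint θ pS Q) (fun ω => (ω.1, ω.2.1)) a]
  refine Finset.sum_congr rfl fun z _ => ?_
  rw [← prob_joint_input θ pS Q]
  simp

/-- Conditional mutual informations of single letters are bounded by those of the block. -/
theorem IsVirtualChannel.condMutualInfo_le (hQ : IsVirtualChannel Q pS W f g₁ g₂)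
    {D D' E E' T Y' : Type*} [Fintype D] [Fintype D'] [Fintype E] [Fintype E'] [Fintype T]
    [Fintype Y']
    (a : (C₀ × C₁ × C₂) × S → D) (b : (C₀ × C₁ × C₂) × S → D')
    {A : (Fin m → C₀ × C₁ × C₂) × (Fin m → S) × (Fin n → Y₁ × Y₂) → E}
    {B : (Fin m → C₀ × C₁ × C₂) × (Fin m → S) × (Fin n → Y₁ × Y₂) → E'}
    (hA : ∀ ω ω', A ω = A ω' ↔ ∀ t, a (ω.1 t, ω.2.1 t) = a (ω'.1 t, ω'.2.1 t))
    (hB : ∀ ω ω', B ω = B ω' ↔ ∀ t, b (ω.1 t, ω.2.1 t) = b (ω'.1 t, ω'.2.1 t))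
    (π : T₁ × T₂ → T) (η : Y₁ × Y₂ → Y')
    (hπ : ∀ t y y', (fun q => η (y q)) = (fun q => η (y' q)) →
      π (reconstruction g₁ g₂ t y) = π (reconstruction g₁ g₂ t y')) :
    m * condMutualInfo (joint θ pS Q) (fun ω => a (ω.1, ω.2.1)) (fun ω => π ω.2.2)
        (fun ω => b (ω.1, ω.2.1)) ≤
      condMutualInfo (codeLaw θ pS W f) A (fun ω q => η (ω.2.2 q)) B := by
  rw [condMutualInfo_eq', condMutualInfo_eq', mul_sub]
  -- The unconditioned term is additive with equality. The other is bounded by subadditivity,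
  -- reconstructions being functions of the outputs (`h2`), and by concavity, the single-letter law
  -- being the time average (`h3`).
  have h1 : (m : ℝ) * condEntropy (joint θ pS Q) (fun ω => a (ω.1, ω.2.1))
      (fun ω => b (ω.1, ω.2.1)) = condEntropy (codeLaw θ pS W f) A B := by
    rw [condEntropy, condEntropy, entropy_codeLaw_iid θ Q b hB,
      entropy_codeLaw_iid θ Q (fun z => (a z, b z)) (A := fun ω => (A ω, B ω)) (fun ω ω' => by
        simp only [Prod.mk.injEq, hA, hB, forall_and])]
    ring
  have h2 : condEntropy (codeLaw θ pS W f) A (fun ω => ((fun q => η (ω.2.2 q)), B ω)) ≤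
      ∑ t, condEntropy (codeLaw θ pS W f) (fun ω => a (ω.1 t, ω.2.1 t))
        (fun ω => (π (reconstruction g₁ g₂ t ω.2.2), b (ω.1 t, ω.2.1 t))) := by
    rw [condEntropy_congr (codeLaw θ pS W f) (X := A) (X' := fun ω t => a (ω.1 t, ω.2.1 t))
      (Z' := fun ω => ((fun q => η (ω.2.2 q)), B ω)) (fun ω ω' => by simp only [funext_iff, hA])
      (fun ω ω' => Iff.rfl)]
    refine (condEntropy_pi_le (codeLaw θ pS W f) _ fun t ω => a (ω.1 t, ω.2.1 t)).trans
      (Finset.sum_le_sum fun t _ => condEntropy_anti _ _ fun ω ω' h => ?_)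
    obtain ⟨hy, hb⟩ := Prod.mk.inj h
    exact Prod.ext (hπ t _ _ hy) ((hB _ _).1 hb t)
  have h3 : ∑ t, condEntropy (codeLaw θ pS W f) (fun ω => a (ω.1 t, ω.2.1 t))
        (fun ω => (π (reconstruction g₁ g₂ t ω.2.2), b (ω.1 t, ω.2.1 t))) ≤
      m * condEntropy (joint θ pS Q) (fun ω => a (ω.1, ω.2.1))
        (fun ω => (π ω.2.2, b (ω.1, ω.2.1))) := by
    simp only [condEntropy_eq_sum]
    rw [Finset.sum_comm, Finset.mul_sum]
    refine Finset.sum_le_sum fun z _ => ?_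
    rw [← homEntropy_smul]
    refine (sum_homEntropy_le _ fun t x => prob_nonneg _ _ _).trans (le_of_eq ?_)
    congr 1
    ext x
    rw [Finset.sum_apply, Pi.smul_apply, smul_eq_mul]
    exact (hQ.prob_joint_eq θ (fun ω => (a (ω.1, ω.2.1), π ω.2.2, b (ω.1, ω.2.1))) (x, z)).symm
  linarith

/-- The single-letter information quantities are bounded by those of the block. -/
theorem IsVirtualChannel.measurements_le (hQ : IsVirtualChannel Q pS W f g₁ g₂) (j : Fin 10) :
    m * measurements θ pS Q j ≤ infoVector (codeLaw θ pS W f) (fun ω t => (ω.1 t).1)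
      (fun ω t => (ω.1 t).2.1) (fun ω t => (ω.1 t).2.2) (fun ω => ω.2.1)
      (fun ω q => (ω.2.2 q).1) (fun ω q => (ω.2.2 q).2) j := by
  have k1 : ∀ (t : Fin m) (y y' : Fin n → Y₁ × Y₂), (fun q => (y q).1) = (fun q => (y' q).1) →
      (reconstruction g₁ g₂ t y).1 = (reconstruction g₁ g₂ t y').1 := fun t y y' h => by
    simp only [reconstruction, h]
  have k2 : ∀ (t : Fin m) (y y' : Fin n → Y₁ × Y₂), (fun q => (y q).2) = (fun q => (y' q).2) →
      (reconstruction g₁ g₂ t y).2 = (reconstruction g₁ g₂ t y').2 := fun t y y' h => by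
    simp only [reconstruction, h]
  have i01 := hQ.condMutualInfo_le θ (fun z => z.1.1) (fun _ => ()) (A := fun ω t => (ω.1 t).1)
    (B := fun _ => ()) (by simp [funext_iff]) (by simp) Prod.fst Prod.fst k1
  have i02 := hQ.condMutualInfo_le θ (fun z => z.1.1) (fun _ => ()) (A := fun ω t => (ω.1 t).1)
    (B := fun _ => ()) (by simp [funext_iff]) (by simp) Prod.snd Prod.snd k2
  have i1 := hQ.condMutualInfo_le θ (fun z => (z.1.1, z.1.2.1)) (fun _ => ())
    (A := fun ω => ((fun t => (ω.1 t).1), fun t => (ω.1 t).2.1))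
    (B := fun _ => ()) (by simp [funext_iff, forall_and]) (by simp) Prod.fst Prod.fst k1
  have i2 := hQ.condMutualInfo_le θ (fun z => (z.1.1, z.1.2.2)) (fun _ => ())
    (A := fun ω => ((fun t => (ω.1 t).1), fun t => (ω.1 t).2.2))
    (B := fun _ => ()) (by simp [funext_iff, forall_and]) (by simp) Prod.snd Prod.snd k2
  have c2 := hQ.condMutualInfo_le θ (fun z => z.1.2.2) (fun z => z.1.1)
    (A := fun ω t => (ω.1 t).2.2) (B := fun ω t => (ω.1 t).1) (by simp [funext_iff])
    (by simp [funext_iff]) Prod.snd Prod.snd k2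
  have c1 := hQ.condMutualInfo_le θ (fun z => z.1.2.1) (fun z => z.1.1)
    (A := fun ω t => (ω.1 t).2.1) (B := fun ω t => (ω.1 t).1) (by simp [funext_iff])
    (by simp [funext_iff]) Prod.fst Prod.fst k1
  have s2 := hQ.condMutualInfo_le θ (fun z => z.2) (fun z => (z.1.1, z.1.2.1))
    (A := fun ω => ω.2.1) (B := fun ω => ((fun t => (ω.1 t).1), fun t => (ω.1 t).2.1))
    (by simp [funext_iff]) (by simp [funext_iff, forall_and]) Prod.snd Prod.snd k2
  have s1 := hQ.condMutualInfo_le θ (fun z => z.2) (fun z => (z.1.1, z.1.2.2))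
    (A := fun ω => ω.2.1) (B := fun ω => ((fun t => (ω.1 t).1), fun t => (ω.1 t).2.2))
    (by simp [funext_iff]) (by simp [funext_iff, forall_and]) Prod.fst Prod.fst k1
  simp only [← mutualInfo_eq_condMutualInfo] at i01 i02 i1 i2
  fin_cases j <;>
    simp only [measurements, infoVector, Fin.reduceFinMk, Matrix.cons_val, Fin.zero_eta,
      Fin.mk_one, Fin.isValue] <;>
    linarith

end SourceSide

/-! ### Single-letter converse for a block code -/

section SingleLetter

variable {Ω A B C : Type*} [Fintype Ω] [Fintype A] [Fintype B] [Fintype C]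

lemma mutualInfo_nonneg (p : Distr Ω) (X : Ω → A) (Y : Ω → B) : 0 ≤ mutualInfo p X Y := by
  rw [mutualInfo_eq]
  exact sub_nonneg.2 (condEntropy_le_entropy p Y X)

lemma condMutualInfo_nonneg (p : Distr Ω) (X : Ω → A) (Y : Ω → B) (Z : Ω → C) :
    0 ≤ condMutualInfo p X Y Z := by
  rw [condMutualInfo_eq]
  exact sub_nonneg.2 (condEntropy_anti p Y fun _ _ h => (Prod.mk.inj h).2)

variable {S T₁ T₂ X Y₁ Y₂ C₀ C₁ C₂ : Type*} [Fintype S] [Fintype T₁] [Fintype T₂] [Fintype X]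
  [Fintype Y₁] [Fintype Y₂] [Fintype C₀] [Fintype C₁] [Fintype C₂]

lemma measurements_nonneg (θ : Channel S (C₀ × C₁ × C₂)) (p : Distr S) (K : Channel S (Y₁ × Y₂))
    (j : Fin 10) : 0 ≤ measurements θ p K j := by
  fin_cases j <;>
    simp only [measurements, Fin.reduceFinMk, Matrix.cons_val, Fin.zero_eta, Fin.mk_one,
      Fin.isValue] <;>
    first
    | exact mutualInfo_nonneg _ _ _
    | exact add_nonneg (mutualInfo_nonneg _ _ _) (condMutualInfo_nonneg _ _ _ _)
    | exact add_nonneg (add_nonneg (mutualInfo_nonneg _ _ _) (condMutualInfo_nonneg _ _ _ _))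
        (condMutualInfo_nonneg _ _ _ _)

lemma infoBounds_smul (K : Channel X (Y₁ × Y₂)) (c : ℝ) (x : EntropySpace X) :
    infoBounds K (c • x) = c • infoBounds K x := by
  ext j
  fin_cases j <;> simp [infoBounds, outEntropy_smul, noiseEntropy_smul] <;> ring

/-- Each test channel for the virtual channel of a block code is matched by one for the physical
channel. -/
theorem exists_virtualChannel_inputLaw [Nonempty X] {m n : ℕ} (hm : 0 < m) (pS : Distr S)
    (W : Channel X (Y₁ × Y₂)) (f : (Fin m → S) → (Fin n → X)) (g₁ : (Fin n → Y₁) → (Fin m → T₁))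
    (g₂ : (Fin n → Y₂) → (Fin m → T₂)) :
    ∃ (Q : Channel S (T₁ × T₂)) (pX : Distr X), IsVirtualChannel Q pS W f g₁ g₂ ∧
      ∀ (k₀ k₁ k₂ : ℕ) (U : Channel S (Fin k₀ × Fin k₁ × Fin k₂)),
        ∃ V : Channel X (Fin (Fintype.card X + 5) × Fin (Fintype.card X) × Fin (Fintype.card X)),
          ∀ j, m * measurements U pS Q j ≤ n * measurements V pX W j := by
  obtain ⟨Q, hQ⟩ := exists_virtualChannel hm pS W f g₁ g₂
  have main : ∀ {k₀ k₁ k₂ : ℕ} (U : Channel S (Fin k₀ × Fin k₁ × Fin k₂)),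
      ∃ x ∈ entropyCone W, x.1.1 = ∑ q, prob (blockLaw pS W f) (fun ω => f ω.1 q) ∧
        ∀ j, m * measurements U pS Q j ≤ infoBounds W x j := by
    intro k₀ k₁ k₂ U
    have hmem : IsMemoryless (codeLaw U pS W f) (fun ω t => (ω.1 t).1) (fun ω t => (ω.1 t).2.1)
        (fun ω t => (ω.1 t).2.2) (fun ω => ω.2.1) (fun ω => f ω.2.1) (fun ω => ω.2.2) W := fun q =>
      (isMarkov_codeLaw_channel U pS W f q).comp fun z =>
        (((fun t => (z.1.1 t).1), (fun t => (z.1.1 t).2.1), (fun t => (z.1.1 t).2.2), z.1.2), z.2)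
    refine ⟨∑ q, letterPoint (codeLaw U pS W f) (fun ω => ω.2.2) (fun ω t => (ω.1 t).1)
      (fun ω t => (ω.1 t).2.1) (fun ω t => (ω.1 t).2.2) (fun ω => f ω.2.1) q,
      Submodule.sum_mem _ fun q _ => hmem.letterPoint_mem q, ?_, fun j =>
      (hQ.measurements_le U j).trans (hmem.infoVector_le j)⟩
    simp only [Prod.fst_sum, letterPoint, auxPoint]
    exact Finset.sum_congr rfl fun q _ => prob_codeLaw_block U pS W f fun z => f z.1 q
  -- Without channel uses there is no average input law; the accumulated vector is 0, so all
  -- quantities on the source side are at most 0 and any `pX` works.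
  rcases Nat.eq_zero_or_pos n with rfl | hn
  · obtain ⟨pX⟩ : Nonempty (Distr X) := inferInstance
    have : NeZero (Fintype.card X) := ⟨Fintype.card_ne_zero⟩
    refine ⟨Q, pX, hQ, fun k₀ k₁ k₂ U => ?_⟩
    obtain ⟨V⟩ : Nonempty (Channel X (Fin (Fintype.card X + 5) × Fin (Fintype.card X) ×
      Fin (Fintype.card X))) := inferInstance
    refine ⟨V, fun j => (hQ.measurements_le U j).trans ?_⟩
    have hmem : IsMemoryless (codeLaw U pS W f) (fun ω t => (ω.1 t).1) (fun ω t => (ω.1 t).2.1)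
        (fun ω t => (ω.1 t).2.2) (fun ω => ω.2.1) (fun ω => f ω.2.1) (fun ω => ω.2.2) W :=
      fun q => q.elim0
    refine (hmem.infoVector_le j).trans (le_of_eq ?_)
    have h0 := infoBounds_smul W 0 0
    rw [Finset.univ_eq_empty, Finset.sum_empty, ← zero_smul ℝ (0 : EntropySpace X), h0]
    simp
  · have hn' : (0 : ℝ) < n := Nat.cast_pos.2 hn
    let pX : Distr X := ⟨(1 / (n : ℝ)) • ∑ q, prob (blockLaw pS W f) (fun ω => f ω.1 q),
      smul_nonneg (by positivity) (Finset.sum_nonneg fun q _ => prob_nonneg' _ _), by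
        simp only [Pi.smul_apply, Finset.sum_apply, smul_eq_mul, ← Finset.mul_sum]
        rw [Finset.sum_comm]
        simp [sum_prob, hn'.ne']⟩
    refine ⟨Q, pX, hQ, fun k₀ k₁ k₂ U => ?_⟩
    obtain ⟨x, hx, hxl, hle⟩ := main U
    -- Scaling by 1/n normalises the law to `pX`; homogeneity of `infoBounds` returns the factor n.
    obtain ⟨V, hV⟩ := exists_channel_ge (p := pX) (smul_mem_coneSpan (c := 1 / (n : ℝ))
      (by positivity) hx) (by rw [Prod.smul_fst, Prod.smul_fst, hxl]; rfl)
    refine ⟨V, fun j => (hle j).trans ?_⟩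
    have := hV j
    rw [infoBounds_smul, Pi.smul_apply, smul_eq_mul, one_div, inv_mul_le_iff₀ hn'] at this
    exact this

end SingleLetter

/-! ### Limits of codes -/

section Limits

lemma continuous_joint {A B₁ B₂ C₀ C₁ C₂ : Type*} [Fintype A] [Fintype B₁] [Fintype B₂]
    [Fintype C₀] [Fintype C₁] [Fintype C₂] :
    Continuous fun t : Channel A (C₀ × C₁ × C₂) × Distr A × Channel A (B₁ × B₂) =>
      joint t.1 t.2.1 t.2.2 := by
  refine Continuous.subtype_mk (continuous_pi fun ω => ?_) _
  refine ((?_ : Continuous _).mul ?_).mul ?_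
  · exact (continuous_apply ω.1).comp (continuous_subtype_val.comp
      ((continuous_apply ω.2.1).comp continuous_fst))
  · exact (continuous_apply ω.2.1).comp (continuous_subtype_val.comp
      (continuous_fst.comp continuous_snd))
  · exact (continuous_apply ω.2.2).comp (continuous_subtype_val.comp
      ((continuous_apply ω.2.1).comp (continuous_snd.comp continuous_snd)))

variable {Ω A B C : Type*} [Fintype Ω] [Fintype A] [Fintype B] [Fintype C]

lemma continuous_mutualInfo (X : Ω → A) (Y : Ω → B) :
    Continuous fun p : Distr Ω => mutualInfo p X Y :=
  ((continuous_entropy _).add (continuous_entropy _)).sub (continuous_entropy _)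

lemma continuous_condMutualInfo (X : Ω → A) (Y : Ω → B) (Z : Ω → C) :
    Continuous fun p : Distr Ω => condMutualInfo p X Y Z :=
  (((continuous_entropy _).add (continuous_entropy _)).sub (continuous_entropy _)).sub
    (continuous_entropy _)

lemma continuous_measurements {A B₁ B₂ C₀ C₁ C₂ : Type*} [Fintype A] [Fintype B₁] [Fintype B₂]
    [Fintype C₀] [Fintype C₁] [Fintype C₂] (j : Fin 10) :
    Continuous fun t : Channel A (C₀ × C₁ × C₂) × Distr A × Channel A (B₁ × B₂) =>
      measurements t.1 t.2.1 t.2.2 j := by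
  fin_cases j <;>
    simp only [measurements, Fin.reduceFinMk, Matrix.cons_val, Fin.zero_eta, Fin.mk_one,
      Fin.isValue] <;>
    first
    | exact (continuous_mutualInfo _ _).comp continuous_joint
    | exact ((continuous_mutualInfo _ _).add (continuous_condMutualInfo _ _ _)).comp
        continuous_joint
    | exact (((continuous_mutualInfo _ _).add (continuous_condMutualInfo _ _ _)).add
        (continuous_condMutualInfo _ _ _)).comp continuous_joint

lemma tendsto_measurements {ι A B₁ B₂ C₀ C₁ C₂ : Type*} [Fintype A] [Fintype B₁] [Fintype B₂]
    [Fintype C₀] [Fintype C₁] [Fintype C₂] {l : Filter ι} {θ : ι → Channel A (C₀ × C₁ × C₂)}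
    {p : ι → Distr A} {K : ι → Channel A (B₁ × B₂)} {θ' : Channel A (C₀ × C₁ × C₂)}
    {p' : Distr A} {K' : Channel A (B₁ × B₂)} (hθ : Filter.Tendsto θ l (nhds θ'))
    (hp : Filter.Tendsto p l (nhds p')) (hK : Filter.Tendsto K l (nhds K')) (j : Fin 10) :
    Filter.Tendsto (fun i => measurements (θ i) (p i) (K i) j) l
      (nhds (measurements θ' p' K' j)) := by
  have key : ∀ F : Channel A (C₀ × C₁ × C₂) × Distr A × Channel A (B₁ × B₂) → ℝ, Continuous F →
      Filter.Tendsto (fun i => F (θ i, p i, K i)) l (nhds (F (θ', p', K'))) := fun F hF =>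
    (hF.tendsto (θ', p', K')).comp (hθ.prodMk_nhds (hp.prodMk_nhds hK))
  exact key (fun t => measurements t.1 t.2.1 t.2.2 j) (continuous_measurements j)

/-- One ultrafilter serves for `Q` and `pX` and for the channels `V` of every test at once, with no
subsequence depending on the test. -/
lemma exists_tendsto_hyperfilter {Z : Type*} [TopologicalSpace Z] [CompactSpace Z] (u : ℕ → Z) :
    ∃ z, Filter.Tendsto u (Filter.hyperfilter ℕ : Filter ℕ) (nhds z) := by
  have : Nonempty Z := ⟨u 0⟩
  exact ⟨_, ((Filter.hyperfilter ℕ).map u).le_nhds_lim⟩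

end Limits

/-! ### Passage to the limit and reduction to small test alphabets -/

section Main

lemma Achievable.nonneg {S T₁ T₂ X Y₁ Y₂ : Type*} [Fintype S] [Fintype Y₁] [Fintype Y₂]
    {pS : Distr S} {W : Channel X (Y₁ × Y₂)} {w₁ : S → T₁ → ℝ≥0} {w₂ : S → T₂ → ℝ≥0} {κ d₁ d₂ : ℝ}
    (h : Achievable pS W w₁ w₂ κ d₁ d₂) : 0 ≤ κ := by
  by_contra! hκ
  obtain ⟨m, n, -, -, -, hm, hmn, -⟩ := h (-κ / 2) (by linarith)
  have : (0 : ℝ) ≤ (n : ℝ) / m := by positivity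
  linarith

variable {S T₁ T₂ X Y₁ Y₂ : Type*} [Fintype S] [Fintype T₁] [Fintype T₂] [Fintype X]
  [Fintype Y₁] [Fintype Y₂] {pS : Distr S} {W : Channel X (Y₁ × Y₂)} {w₁ : S → T₁ → ℝ≥0}
  {w₂ : S → T₂ → ℝ≥0} {κ d₁ d₂ : ℝ}

/-- The necessary condition for achievability. -/
theorem Achievable.exists_virtualChannel [Nonempty X] (h : Achievable pS W w₁ w₂ κ d₁ d₂) :
    ∃ (Q : Channel S (T₁ × T₂)) (pX : Distr X),
      distortion₁ pS Q w₁ ≤ d₁ ∧ distortion₂ pS Q w₂ ≤ d₂ ∧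
      ∀ (k₀ k₁ k₂ : ℕ) (U : Channel S (Fin k₀ × Fin k₁ × Fin k₂)),
        ∃ V : Channel X (Fin (Fintype.card X + 5) × Fin (Fintype.card X) × Fin (Fintype.card X)),
          ∀ j, measurements U pS Q j ≤ κ * measurements V pX W j := by
  have step : ∀ k : ℕ, ∃ (Q : Channel S (T₁ × T₂)) (pX : Distr X),
      distortion₁ pS Q w₁ ≤ d₁ + 1 / ((k : ℝ) + 1) ∧
      distortion₂ pS Q w₂ ≤ d₂ + 1 / ((k : ℝ) + 1) ∧
      ∀ (k₀ k₁ k₂ : ℕ) (U : Channel S (Fin k₀ × Fin k₁ × Fin k₂)),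
        ∃ V : Channel X (Fin (Fintype.card X + 5) × Fin (Fintype.card X) × Fin (Fintype.card X)),
          ∀ j, measurements U pS Q j ≤ (κ + 1 / ((k : ℝ) + 1)) * measurements V pX W j := by
    intro k
    obtain ⟨m, n, f, g₁, g₂, hm, hmn, h₁, h₂⟩ := h (1 / ((k : ℝ) + 1)) (by positivity)
    obtain ⟨Q, pX, hQ, hU⟩ := exists_virtualChannel_inputLaw hm pS W f g₁ g₂
    refine ⟨Q, pX, (hQ.distortion₁_eq hm w₁).trans_le h₁, (hQ.distortion₂_eq hm w₂).trans_le h₂,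
      fun k₀ k₁ k₂ U => ?_⟩
    obtain ⟨V, hV⟩ := hU k₀ k₁ k₂ U
    have hm' : (0 : ℝ) < m := Nat.cast_pos.2 hm
    -- Replacing n/m by its upper bound requires the quantities to be nonnegative.
    refine ⟨V, fun j => le_trans ?_
      (mul_le_mul_of_nonneg_right hmn (measurements_nonneg V pX W j))⟩
    rw [div_mul_eq_mul_div, le_div_iff₀ hm', mul_comm]
    exact hV j
  choose Q pX hd₁ hd₂ hU using step
  obtain ⟨Q', hQ'⟩ := exists_tendsto_hyperfilter Q
  obtain ⟨pX', hpX'⟩ := exists_tendsto_hyperfilter pX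
  have hε : Filter.Tendsto (fun k : ℕ => 1 / ((k : ℝ) + 1)) (Filter.hyperfilter ℕ : Filter ℕ)
      (nhds 0) := tendsto_one_div_add_atTop_nhds_zero_nat.mono_left Nat.hyperfilter_le_atTop
  have hεc : ∀ c : ℝ, Filter.Tendsto (fun k : ℕ => c + 1 / ((k : ℝ) + 1))
      (Filter.hyperfilter ℕ : Filter ℕ) (nhds c) := fun c => by
    have := hε.const_add c
    rwa [add_zero] at this
  have hQa : ∀ s r, Filter.Tendsto (fun k => Q k s r) (Filter.hyperfilter ℕ : Filter ℕ)
      (nhds (Q' s r)) := fun s r =>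
    (((continuous_apply r).comp continuous_subtype_val).tendsto (Q' s)).comp
      (((continuous_apply s).tendsto Q').comp hQ')
  refine ⟨Q', pX', ?_, ?_, fun k₀ k₁ k₂ U => ?_⟩
  · have ht : Filter.Tendsto (fun k => distortion₁ pS (Q k) w₁) (Filter.hyperfilter ℕ : Filter ℕ)
        (nhds (distortion₁ pS Q' w₁)) :=
      tendsto_finsetSum _ fun s _ => tendsto_finsetSum _ fun r _ =>
        ((hQa s r).const_mul (pS s)).mul_const _
    exact le_of_tendsto_of_tendsto' ht (hεc d₁) hd₁
  · have ht : Filter.Tendsto (fun k => distortion₂ pS (Q k) w₂) (Filter.hyperfilter ℕ : Filter ℕ)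
        (nhds (distortion₂ pS Q' w₂)) :=
      tendsto_finsetSum _ fun s _ => tendsto_finsetSum _ fun r _ =>
        ((hQa s r).const_mul (pS s)).mul_const _
    exact le_of_tendsto_of_tendsto' ht (hεc d₂) hd₂
  · choose V hV using fun k => hU k k₀ k₁ k₂ U
    obtain ⟨V', hV'⟩ := exists_tendsto_hyperfilter V
    refine ⟨V', fun j => ?_⟩
    have hl := tendsto_measurements (tendsto_const_nhds (x := U))
      (tendsto_const_nhds (x := pS)) hQ' j
    have hr := tendsto_measurements hV' hpX' (tendsto_const_nhds (x := W)) j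
    exact le_of_tendsto_of_tendsto' hl ((hεc κ).mul hr) fun k => hV k j

/-- Test channels can be replaced by test channels with small alphabets. -/
lemma exists_small_channel (hκ : 0 ≤ κ) {pX : Distr X} {x : Fin 10 → ℝ} {l₀ l₁ l₂ : ℕ}
    (V : Channel X (Fin l₀ × Fin l₁ × Fin l₂)) (hV : ∀ j, x j ≤ κ * measurements V pX W j) :
    ∃ V' : Channel X (Fin (Fintype.card X + 5) × Fin (Fintype.card X) × Fin (Fintype.card X)),
      ∀ j, x j ≤ κ * measurements V' pX W j := by
  obtain ⟨V', h⟩ := exists_channel_ge (channelPoint_mem V pX W) (channelPoint_law V pX W)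
  rw [← measurements_eq] at h
  exact ⟨V', fun j => (hV j).trans (mul_le_mul_of_nonneg_left (h j) hκ)⟩

/-- It suffices to test with alphabets of the size of the source alphabet. -/
lemma exists_channel_of_small_tests (hκ : 0 ≤ κ) {Q : Channel S (T₁ × T₂)} {pX : Distr X}
    (h : ∀ U : Channel S (Fin (Fintype.card S) × Fin (Fintype.card S) × Fin (Fintype.card S)),
      ∃ (l₀ l₁ l₂ : ℕ) (V : Channel X (Fin l₀ × Fin l₁ × Fin l₂)),
        ∀ j, measurements U pS Q j ≤ κ * measurements V pX W j)
    {k₀ k₁ k₂ : ℕ} (U : Channel S (Fin k₀ × Fin k₁ × Fin k₂)) :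
    ∃ V : Channel X (Fin (Fintype.card X + 5) × Fin (Fintype.card X) × Fin (Fintype.card X)),
      ∀ j, measurements U pS Q j ≤ κ * measurements V pX W j := by
  -- The source vectors of law `pS` dominated by some physical vector of law `pX` form a convex set:
  -- witnesses are mixed with the same weights, and `infoBounds` is affine on both sides. It
  -- contains the small tests, hence their mixtures.
  have key := convexHull_min (t := {y : EntropySpace S | y.1.1 = pS ∧ ∃ x ∈ entropyCone W,
      x.1.1 = pX ∧ ∀ j, infoBounds Q y j ≤ κ * infoBounds W x j}) ?_ ?_
    (mem_convexHull_channelPoint (channelPoint_mem U pS Q) (channelPoint_law U pS Q))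
  · obtain ⟨-, x, hx, hxp, hle⟩ := key
    obtain ⟨V, hV⟩ := exists_channel_ge hx hxp
    refine ⟨V, fun j => ?_⟩
    rw [measurements_eq U]
    exact (hle j).trans (mul_le_mul_of_nonneg_left (hV j) hκ)
  · rintro _ ⟨U', rfl⟩
    obtain ⟨l₀, l₁, l₂, V, hV⟩ := h U'
    refine ⟨channelPoint_law U' pS Q, channelPoint V pX W, channelPoint_mem V pX W,
      channelPoint_law V pX W, fun j => ?_⟩
    rw [← measurements_eq, ← measurements_eq]
    exact hV j
  · rintro y ⟨hy, x, hx, hxp, hle⟩ y' ⟨hy', x', hx', hxp', hle'⟩ a b ha hb hab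
    refine ⟨?_, a • x + b • x', convex_coneSpan _ hx hx' ha hb hab, ?_, fun j => ?_⟩
    · simp [hy, hy', ← add_smul, hab]
    · simp [hxp, hxp', ← add_smul, hab]
    · rw [infoBounds_convexComb Q (hy.trans hy'.symm) hab,
        infoBounds_convexComb W (hxp.trans hxp'.symm) hab]
      simp only [Pi.add_apply, Pi.smul_apply, smul_eq_mul]
      have := mul_le_mul_of_nonneg_left (hle j) ha
      have := mul_le_mul_of_nonneg_left (hle' j) hb
      linarith

end Main

end

end SourceBroadcast

theorem theorem1 {S T₁ T₂ X Y₁ Y₂ : Type*}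
    [Fintype S] [Fintype T₁] [Fintype T₂] [Fintype X] [Nonempty X] [Fintype Y₁] [Fintype Y₂]
    (pS : Distr S) (W : Channel X (Y₁ × Y₂)) (w₁ : S → T₁ → ℝ≥0) (w₂ : S → T₂ → ℝ≥0)
    (κ d₁ d₂ : ℝ) (hach : Achievable pS W w₁ w₂ κ d₁ d₂) :
    -- the necessary condition: `U₀, U₁, U₂` range over all finite alphabets,
    -- and `V₀, V₁, V₂` can be found within the cardinality bounds
    (∃ (Q : Channel S (T₁ × T₂)) (pX : Distr X),
      distortion₁ pS Q w₁ ≤ d₁ ∧ distortion₂ pS Q w₂ ≤ d₂ ∧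
      ∀ (k₀ k₁ k₂ : ℕ) (U : Channel S (Fin k₀ × Fin k₁ × Fin k₂)),
        ∃ (l₀ l₁ l₂ : ℕ) (V : Channel X (Fin l₀ × Fin l₁ × Fin l₂)),
          l₀ ≤ Fintype.card X + 5 ∧ l₁ ≤ Fintype.card X ∧ l₂ ≤ Fintype.card X ∧
          ∀ j, measurements U pS Q j ≤ κ * measurements V pX W j) ∧
    -- it suffices to consider test distributions within the cardinality bounds
    (∀ (Q : Channel S (T₁ × T₂)) (pX : Distr X),
      (∀ (k₀ k₁ k₂ : ℕ) (U : Channel S (Fin k₀ × Fin k₁ × Fin k₂)),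
        k₀ ≤ Fintype.card S → k₁ ≤ Fintype.card S → k₂ ≤ Fintype.card S →
        ∃ (l₀ l₁ l₂ : ℕ) (V : Channel X (Fin l₀ × Fin l₁ × Fin l₂)),
          l₀ ≤ Fintype.card X + 5 ∧ l₁ ≤ Fintype.card X ∧ l₂ ≤ Fintype.card X ∧
          ∀ j, measurements U pS Q j ≤ κ * measurements V pX W j) ↔
      (∀ (k₀ k₁ k₂ : ℕ) (U : Channel S (Fin k₀ × Fin k₁ × Fin k₂)),
        ∃ (l₀ l₁ l₂ : ℕ) (V : Channel X (Fin l₀ × Fin l₁ × Fin l₂)),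
          ∀ j, measurements U pS Q j ≤ κ * measurements V pX W j)) := by
  -- The second half uses achievability only through κ ≥ 0.
  have hκ := hach.nonneg
  refine ⟨?_, fun Q pX => ⟨fun h k₀ k₁ k₂ U => ?_, fun h k₀ k₁ k₂ U _ _ _ => ?_⟩⟩
  · obtain ⟨Q, pX, h₁, h₂, h⟩ := hach.exists_virtualChannel
    refine ⟨Q, pX, h₁, h₂, fun k₀ k₁ k₂ U => ?_⟩
    obtain ⟨V, hV⟩ := h k₀ k₁ k₂ U
    exact ⟨_, _, _, V, le_rfl, le_rfl, le_rfl, hV⟩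
  · obtain ⟨V, hV⟩ := exists_channel_of_small_tests hκ (fun U => by
      obtain ⟨l₀, l₁, l₂, V, -, -, -, hV⟩ := h _ _ _ U le_rfl le_rfl le_rfl
      exact ⟨l₀, l₁, l₂, V, hV⟩) U
    exact ⟨_, _, _, V, hV⟩
  · obtain ⟨l₀, l₁, l₂, V, hV⟩ := h k₀ k₁ k₂ U
    obtain ⟨V', hV'⟩ := exists_small_channel hκ V hV
    exact ⟨_, _, _, V', le_rfl, le_rfl, le_rfl, hV'⟩
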